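/- Let $(X,\mathcal A,\mu)$ be a $\sigma$-finite measure space with $\mu(X)=\infty$ and $\mu$ continuous (nonatomic: every $A\in\mathcal A$ with $\mu(A)>0$ is the disjoint union of two measurable sets of positive measure). Let $X^*$ be the set of counting measures $\nu=\sum_{i\in I}\delta_{x_i}$ on $X$ ($I$ countable, $x_i\in X$), put $N(A)(\nu)=\nu(A)$ for $A\in\mathcal A$, and let $\mathcal A^*=\sigma\{N(A):A\in\mathcal A\}$. Let $\mu^*$ be the Poisson measure of intensity $\mu$, i.e. the probability measure on $(X^*,\mathcal A^*)$ such that for all pairwise disjoint $A_1,\dots,A_k\in\mathcal A$ with $0<\mu(A_i)<\infty$ the random variables $N(A_1),\dots,N(A_k)$ are independent and Poisson distributed with parameters $\mu(A_1),\dots,\mu(A_k)$. For $n\ge 0$ let $H^n\subset L^2(\mu^*)$ (complex-valued functions) be the chaos of order $n$, i.e. the range of the $n$-fold multiple stochastic integral on $L^2_{\mathrm{sym}}(\mu^{\otimes n})$; equivalently, $H^n$ is the closed linear span of the products $\prod_{i=1}^n\bigl(N(A_i)-\mu(A_i)\bigr)$ with $A_1,\dots,A_n\in\mathcal A$ pairwise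 disjoint and of finite measure. **Theorem.** Let $\mathcal C\subset\mathcal A^*$ be a $\sigma$-algebra and let $\Phi=\mathbb E[\,\cdot\mid\mathcal C]$ be the corresponding conditional expectation on $L^2(\mu^*)$. Suppose that $\Phi(H^n)\subset H^n$ for every $n\ge1$ and that $\Phi F=0$ for every $F\in H^1$. Then $\Phi F=0$ for every $F\in H^n$ and every $n\ge 1$. In other words, $\Phi$ is the conditional expectation on the trivial $\sigma$-algebra $\{X^*,\emptyset\}$; that is, $\mathcal C$ is trivial modulo $\mu^*$: $\mu^*(S)\in\{0,1\}$ for every $S\in\mathcal C$. -/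

import Mathlib

open MeasureTheory ProbabilityTheory
open scoped ENNReal NNReal

namespace PoissonChaos

/-- The space `X*` of counting measures on `X`: the measures `∑_{i ∈ I} δ_{x i}` with `I` countable. -/
def CountingMeasure (X : Type*) [MeasurableSpace X] : Type _ :=
  {ν : Measure X // ∃ (I : Type) (_ : Countable I) (x : I → X),
    ν = Measure.sum fun i => Measure.dirac (x i)}

/-- `N A ν = ν A`, the number of points of the counting measure `ν` that fall into `A`. -/
def N {X : Type*} [MeasurableSpace X] (A : Set X) (ν : CountingMeasure X) : ℝ≥0∞ := ν.1 A

/-- The `σ`-algebra `A*` on `X*`: the smallest one for which all the maps `N A`, with `A` measurable,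
are measurable. -/
instance CountingMeasure.sigmaAlgebra {X : Type*} [MeasurableSpace X] :
    MeasurableSpace (CountingMeasure X) :=
  ⨆ (A : Set X) (_ : MeasurableSet A), (borel ℝ≥0∞).comap (N A)

/-- `μ` is continuous (nonatomic): each measurable set of positive measure splits into two measurable
pieces of positive measure. -/
def IsContinuous {X : Type*} [MeasurableSpace X] (μ : Measure X) : Prop :=
  ∀ A, MeasurableSet A → 0 < μ A → ∃ B ⊆ A, MeasurableSet B ∧ 0 < μ B ∧ 0 < μ (A \ B)

/-- The probability measure `P` on `X*` is the Poisson measure `μ*` of intensity `μ`: for disjoint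
measurable sets `A 1, …, A k` of positive finite measure, the random variables `N (A i)` are
independent and Poisson distributed with parameters `μ (A i)`. -/
def IsPoisson {X : Type*} [MeasurableSpace X] (μ : Measure X)
    (P : Measure (CountingMeasure X)) : Prop :=
  ∀ (k : ℕ) (A : Fin k → Set X), (∀ i, MeasurableSet (A i)) → (∀ i, 0 < μ (A i)) →
    (∀ i, μ (A i) < ∞) → Pairwise (fun i j => Disjoint (A i) (A j)) →
    iIndepFun (fun i => N (A i)) P ∧
    ∀ i, P.map (N (A i)) = (poissonMeasure (μ (A i)).toNNReal).map (fun m : ℕ => (m : ℝ≥0∞))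

/-- The multiple stochastic integral `I⁽ⁿ⁾` of the indicator function of `A 1 × ⋯ × A n`, for
disjoint sets `A i` of finite measure: the product of the compensated counts `N (A i) - μ (A i)`. -/
noncomputable def elementaryIntegral {X : Type*} [MeasurableSpace X] (μ : Measure X) {n : ℕ}
    (A : Fin n → Set X) (ν : CountingMeasure X) : ℂ :=
  ∏ i, (((N (A i) ν).toReal - (μ (A i)).toReal : ℝ) : ℂ)

/-- The chaos `Hⁿ` of order `n` in `L²(P)`, where `P` is the Poisson measure of intensity `μ`.
The `n`-fold stochastic integral is the continuous linear extension, from the dense subspace of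
`L²(μ^{⊗n})` spanned by the indicators of products of disjoint sets of finite measure, of the map
`elementaryIntegral`; it is, up to the factor `n!`, an isometry on symmetric functions, so its range
`Hⁿ` is the closed span of the elementary integrals. -/
noncomputable def chaos {X : Type*} [MeasurableSpace X] (μ : Measure X)
    (P : Measure (CountingMeasure X)) (n : ℕ) : Submodule ℂ (Lp ℂ 2 P) :=
  (Submodule.span ℂ {F : Lp ℂ 2 P | ∃ A : Fin n → Set X, (∀ i, MeasurableSet (A i)) ∧
    (∀ i, μ (A i) < ∞) ∧ Pairwise (fun i j => Disjoint (A i) (A j)) ∧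
    F =ᵐ[P] elementaryIntegral μ A}).topologicalClosure

/-- The conditional expectation on the sub-`σ`-algebra `C`, as an operator of `L²(P)`. -/
noncomputable def condExpOp {Ω : Type*} (C : MeasurableSpace Ω) {m0 : MeasurableSpace Ω}
    (P : Measure Ω) (hC : C ≤ m0) : Lp ℂ 2 P →L[ℂ] Lp ℂ 2 P :=
  (lpMeas ℂ ℂ C 2 P).subtypeL ∘L condExpL2 ℂ ℂ hC

end PoissonChaos

namespace PoissonChaos

/-! ### Factorial and central moments of the Poisson law. -/

section PoissonMoments

/-! Weight the squared modulus of a chaos element by a count. For `F` in the chaos of order `n` and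
`S` of finite measure, `E[|F|² N(S)]` is `μ(S) ‖F‖²` plus an excess that counts how many of the `n`
arguments of the kernel fall into `S`. The excess is a nonnegative quadratic form, at most `n ‖F‖²`,
with equality when the kernel lives on `S` (`le_weightedSq`, `weightedSq_le`,
`exists_lintegral_enorm_sq_mul_N_eq`).

Since `Φ` kills `N(S) - μ(S)`, the measure `N(S) · P` agrees with `μ(S) · P` on `C`. Hence `|ΦF|²`,
being `C`-measurable, has excess zero for every `S` (`weightedSq_condExpOp`). But `ΦF` again lies in
the chaos of order `n ≥ 1`, where the excess exhausts `n ‖ΦF‖²` as `S` grows, so `ΦF = 0`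
(`eq_zero_of_weightedSq_eq`).

For triviality of `C`, an event `S` of `C` is now uncorrelated with every elementary integral, and
the chaoses must be seen to be rich enough. Nonatomicity enters here: the sets can be cut into atoms
of tiny measures `r_i`, on each of which `exp(iθξ)` is replaced by its projection onto the span of
`1` and `ξ - r_i`, at a cost of order `r_i²`. The product of these projections is a finite sum of
elementary integrals, and the total error, of order `∑ r_i²`, tends to zero under refinement. So `S`
is uncorrelated with all exponentials of counts (`setIntegral_exp_eq`), hence with all events of the
`σ`-algebra generated by the counts, itself included, and `P(S) = P(S)²` (`measure_eq_zero_or_one`).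
-/

lemma hasSum_descFactorial_mul_pow_div_factorial (z : ℂ) (k : ℕ) :
    HasSum (fun n : ℕ => (n.descFactorial k : ℂ) * (z ^ n / n.factorial)) (z ^ k * Complex.exp z) := by
  -- The terms below `k` vanish; after the shift by `k` the series is `z ^ k` times the exponential
  -- series.
  rw [← hasSum_nat_add_iff' k]
  have h0 : ∑ i ∈ Finset.range k, (i.descFactorial k : ℂ) * (z ^ i / i.factorial) = 0 := by
    refine Finset.sum_eq_zero fun i hi => ?_
    rw [Nat.descFactorial_eq_zero_iff_lt.2 (Finset.mem_range.1 hi)]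
    simp
  rw [h0, sub_zero]
  have h := (NormedSpace.expSeries_div_hasSum_exp z).mul_left (z ^ k)
  rw [← Complex.exp_eq_exp_ℂ] at h
  refine h.congr_fun fun n => ?_
  have h1 : ((n + k).factorial : ℂ) = n.factorial * (n + k).descFactorial k := by
    have := Nat.factorial_mul_descFactorial (Nat.le_add_left k n)
    rw [Nat.add_sub_cancel] at this
    exact_mod_cast this.symm
  have h2 : ((n + k).descFactorial k : ℂ) ≠ 0 := by
    rw [Nat.cast_ne_zero, Ne, Nat.descFactorial_eq_zero_iff_lt]
    omega
  have h3 : (n.factorial : ℂ) ≠ 0 := by exact_mod_cast n.factorial_ne_zero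
  rw [h1, pow_add]
  field_simp

lemma integrable_descFactorial_mul_pow_poissonMeasure (r : ℝ≥0) (s : ℂ) (k : ℕ) :
    Integrable (fun n : ℕ => (n.descFactorial k : ℂ) * s ^ n) (poissonMeasure r) := by
  rw [integrable_poissonMeasure_iff]
  have h := (hasSum_descFactorial_mul_pow_div_factorial (r * ‖s‖ : ℂ) k).summable.norm.mul_left
    (Real.exp (-r))
  refine h.congr fun n => ?_
  simp only [norm_mul, norm_div, norm_pow, Complex.norm_natCast, Complex.norm_real,
    Real.norm_eq_abs, NNReal.abs_eq, abs_norm]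
  ring

lemma integral_descFactorial_mul_pow_poissonMeasure (r : ℝ≥0) (s : ℂ) (k : ℕ) :
    ∫ n : ℕ, (n.descFactorial k : ℂ) * s ^ n ∂poissonMeasure r
      = (r * s) ^ k * Complex.exp (r * (s - 1)) := by
  rw [integral_poissonMeasure]
  have h := (hasSum_descFactorial_mul_pow_div_factorial (r * s : ℂ) k).mul_left
    (Complex.exp (-r))
  have h' : Complex.exp (-r) * ((r * s) ^ k * Complex.exp (r * s))
      = (r * s) ^ k * Complex.exp (r * (s - 1)) := by
    rw [mul_left_comm, ← Complex.exp_add]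
    ring_nf
  rw [← h', ← h.tsum_eq]
  refine tsum_congr fun n => ?_
  rw [Complex.real_smul]
  push_cast
  ring

lemma integrable_descFactorial_poissonMeasure (r : ℝ≥0) (k : ℕ) :
    Integrable (fun n : ℕ => (n.descFactorial k : ℝ)) (poissonMeasure r) := by
  have h := (integrable_descFactorial_mul_pow_poissonMeasure r 1 k).re
  simpa using h

lemma integral_descFactorial_poissonMeasure (r : ℝ≥0) (k : ℕ) :
    ∫ n : ℕ, (n.descFactorial k : ℝ) ∂poissonMeasure r = r ^ k := by
  have h := integral_descFactorial_mul_pow_poissonMeasure r 1 k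
  simp only [one_pow, mul_one, sub_self, mul_zero, Complex.exp_zero] at h
  rw [← Complex.ofReal_inj, ← integral_complex_ofReal]
  simpa using h

/-- The factorial moments of the Poisson law are `r ^ i`, so an expansion in falling factorials
yields central moments by substitution. Exponents up to three suffice, because at most three
square-free products of centred variables are ever multiplied. -/
lemma exists_cast_sub_pow_eq_descFactorial (r : ℝ) {k : ℕ} (hk : k ≤ 3) :
    ∃ c : Fin 4 → ℝ, (∀ n : ℕ, ((n : ℝ) - r) ^ k = ∑ i, c i * n.descFactorial i) ∧
      ∑ i : Fin 4, c i * r ^ (i : ℕ) = if k = 0 then 1 else if k = 1 then 0 else r := by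
  have h1 : ∀ n : ℕ, (n.descFactorial 1 : ℝ) = n := by simp
  have h2 : ∀ n : ℕ, (n.descFactorial 2 : ℝ) = n * (n - 1) := by
    rintro (_ | n)
    · simp
    · simp [Nat.descFactorial_succ]; ring
  have h3 : ∀ n : ℕ, (n.descFactorial 3 : ℝ) = n * (n - 1) * (n - 2) := by
    rintro (_ | _ | n)
    · simp
    · simp [Nat.descFactorial_succ]
    · simp [Nat.descFactorial_succ]; ring
  have h : ∀ (c : Fin 4 → ℝ) (n : ℕ), ∑ i, c i * n.descFactorial i =
      c 0 + c 1 * n + c 2 * (n * (n - 1)) + c 3 * (n * (n - 1) * (n - 2)) := fun c n => by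
    rw [Fin.sum_univ_four, ← h3 n, ← h2 n]
    simp
  simp_rw [h, Fin.sum_univ_four]
  interval_cases k
  · exact ⟨![1, 0, 0, 0], by simp, by simp⟩
  · exact ⟨![-r, 1, 0, 0], fun n => by simp; ring, by simp⟩
  · exact ⟨![r ^ 2, 1 - 2 * r, 1, 0], fun n => by simp; ring, by simp; ring⟩
  · exact ⟨![-r ^ 3, 1 - 3 * r + 3 * r ^ 2, 3 - 3 * r, 1], fun n => by simp; ring, by simp; ring⟩

lemma integrable_cast_sub_pow_poissonMeasure (r : ℝ≥0) {k : ℕ} (hk : k ≤ 3) :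
    Integrable (fun n : ℕ => ((n : ℝ) - r) ^ k) (poissonMeasure r) := by
  obtain ⟨c, hc, -⟩ := exists_cast_sub_pow_eq_descFactorial r hk
  simp_rw [hc]
  exact integrable_finsetSum _ fun i _ =>
    (integrable_descFactorial_poissonMeasure r i).const_mul (c i)

/-- The first central moments of the Poisson distribution. -/
lemma integral_cast_sub_pow_poissonMeasure (r : ℝ≥0) {k : ℕ} (hk : k ≤ 3) :
    ∫ n : ℕ, ((n : ℝ) - r) ^ k ∂poissonMeasure r = if k = 0 then 1 else if k = 1 then 0 else (r : ℝ) := by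
  obtain ⟨c, hc, hc'⟩ := exists_cast_sub_pow_eq_descFactorial r hk
  simp_rw [hc]
  rw [integral_finsetSum _ fun (i : Fin 4) _ =>
    (integrable_descFactorial_poissonMeasure r i).const_mul (c i), ← hc']
  simp_rw [integral_const_mul, integral_descFactorial_poissonMeasure]

end PoissonMoments

/-! ### Products of centred independent Poisson variables. -/

section IndependentPoisson

/-- Distinct sets of equal size differ in both directions, so excluding the single index `j` still
leaves a difference. -/
lemma exists_mem_notMem_ne {ι : Type*} {α β : Finset ι} (hc : α.card = β.card)
    (hne : α ≠ β) (j : ι) :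
    ∃ i, i ≠ j ∧ ((i ∈ α ∧ i ∉ β) ∨ (i ∉ α ∧ i ∈ β)) := by
  obtain ⟨a, ha, ha'⟩ : ∃ a ∈ α, a ∉ β := by
    by_contra! hcon
    exact hne (Finset.eq_of_subset_of_card_le hcon hc.ge)
  obtain ⟨b, hb, hb'⟩ : ∃ b ∈ β, b ∉ α := by
    by_contra! hcon
    exact hne (Finset.eq_of_subset_of_card_le hcon hc.le).symm
  by_cases haj : a = j
  · refine ⟨b, ?_, Or.inr ⟨hb', hb⟩⟩
    rintro rfl
    exact hb' (haj ▸ ha)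
  · exact ⟨a, haj, Or.inl ⟨ha, ha'⟩⟩

variable {Ω ι : Type*} {mΩ : MeasurableSpace Ω} [Fintype ι] {P : Measure Ω}

/-- A finite family of independent Poisson variables with parameters `r i`. -/
structure IsPoissonFamily (P : Measure Ω) (ξ : ι → Ω → ℝ) (r : ι → ℝ≥0) : Prop where
  measurable : ∀ i, Measurable (ξ i)
  indep : iIndepFun ξ P
  law : ∀ i, P.map (ξ i) = (poissonMeasure (r i)).map (fun n : ℕ => (n : ℝ))

variable {ξ : ι → Ω → ℝ} {r : ι → ℝ≥0}

lemma IsPoissonFamily.integrable_prod {𝕜 : Type*} [RCLike 𝕜] (h : IsPoissonFamily P ξ r)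
    {φ : ι → ℝ → 𝕜} (hφ : ∀ i, Measurable (φ i))
    (hi : ∀ i, Integrable (fun n : ℕ => φ i n) (poissonMeasure (r i))) :
    Integrable (fun ω => ∏ i, φ i (ξ i ω)) P := by
  have := h.indep.isProbabilityMeasure
  have hm := h.indep.map_fun_eq_pi_map fun i => (h.measurable i).aemeasurable
  have h1 : ∀ i, Integrable (φ i) (P.map (ξ i)) := fun i => by
    rw [h.law i, integrable_map_measure (hφ i).aestronglyMeasurable .of_discrete]
    exact hi i
  have := fun i => Measure.isProbabilityMeasure_map (h.measurable i).aemeasurable (μ := P)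
  have h2 := Integrable.fintype_prod h1
  rw [← hm] at h2
  exact h2.comp_measurable (measurable_pi_lambda _ h.measurable)

lemma IsPoissonFamily.integral_prod {𝕜 : Type*} [RCLike 𝕜] (h : IsPoissonFamily P ξ r)
    {φ : ι → ℝ → 𝕜} (hφ : ∀ i, Measurable (φ i)) :
    ∫ ω, ∏ i, φ i (ξ i ω) ∂P = ∏ i, ∫ n : ℕ, φ i n ∂poissonMeasure (r i) := by
  rw [h.indep.integral_fun_prod_comp (fun i => (h.measurable i).aemeasurable)
    fun i => (hφ i).aestronglyMeasurable]
  refine Finset.prod_congr rfl fun i _ => ?_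
  rw [← integral_map (h.measurable i).aemeasurable (hφ i).aestronglyMeasurable, h.law i,
    integral_map .of_discrete (hφ i).aestronglyMeasurable]

variable [DecidableEq ι]

/-- The product of the centred variables `ξ i - r i` with `i ∈ α`. -/
def centredProd (ξ : ι → Ω → ℝ) (r : ι → ℝ≥0) (α : Finset ι) (ω : Ω) : ℝ :=
  ∏ i ∈ α, (ξ i ω - r i)

lemma centredProd_mul_mul (α β γ : Finset ι) (ω : Ω) :
    centredProd ξ r α ω * centredProd ξ r β ω * centredProd ξ r γ ω =
      ∏ i, (ξ i ω - r i) ^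
        ((if i ∈ α then 1 else 0) + (if i ∈ β then 1 else 0) + (if i ∈ γ then 1 else 0)) := by
  simp only [centredProd, pow_add, Finset.prod_mul_distrib]
  have h : ∀ δ : Finset ι, ∏ i, (ξ i ω - r i) ^ (if i ∈ δ then 1 else 0) =
      ∏ i ∈ δ, (ξ i ω - r i) := fun δ => by
    simp only [pow_ite, pow_one, pow_zero, Finset.prod_ite_mem, Finset.univ_inter]
  simp only [h]

lemma IsPoissonFamily.integrable_centredProd (h : IsPoissonFamily P ξ r) (α β γ : Finset ι) :
    Integrable (fun ω => centredProd ξ r α ω * centredProd ξ r β ω * centredProd ξ r γ ω) P := by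
  simp_rw [centredProd_mul_mul]
  refine h.integrable_prod (φ := fun i u => (u - r i) ^ _) (fun i => by fun_prop) fun i =>
    integrable_cast_sub_pow_poissonMeasure _ ?_
  split_ifs <;> norm_num

lemma IsPoissonFamily.integral_centredProd (h : IsPoissonFamily P ξ r) (α β γ : Finset ι) :
    ∫ ω, centredProd ξ r α ω * centredProd ξ r β ω * centredProd ξ r γ ω ∂P =
      ∏ i, ∫ n : ℕ, ((n : ℝ) - r i) ^
        ((if i ∈ α then 1 else 0) + (if i ∈ β then 1 else 0) + (if i ∈ γ then 1 else 0))
        ∂poissonMeasure (r i) := by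
  simp_rw [centredProd_mul_mul]
  exact h.integral_prod (φ := fun i u => (u - r i) ^ _) (fun i => by fun_prop)

/-- The second and third central moments of a Poisson variable are both `r`, so an additional
centred factor with index in `α` leaves the value unchanged. -/
lemma IsPoissonFamily.integral_centredProd_mul_self (h : IsPoissonFamily P ξ r)
    (α : Finset ι) {γ : Finset ι} (hγ : γ ⊆ α) :
    ∫ ω, centredProd ξ r α ω * centredProd ξ r α ω * centredProd ξ r γ ω ∂P =
      ∏ i ∈ α, (r i : ℝ) := by
  rw [h.integral_centredProd, ← Finset.prod_subset (Finset.subset_univ α)]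
  · refine Finset.prod_congr rfl fun i hi => ?_
    by_cases hiγ : i ∈ γ <;> simp only [hi, hiγ, if_true, if_false]
    · simpa using integral_cast_sub_pow_poissonMeasure (r i) (k := 3) le_rfl
    · simpa using integral_cast_sub_pow_poissonMeasure (r i) (k := 2) (by norm_num)
  · intro i _ hi
    have : i ∉ γ := fun h' => hi (hγ h')
    simp [hi, this]

lemma IsPoissonFamily.integral_centredProd_eq_zero (h : IsPoissonFamily P ξ r)
    (α β γ : Finset ι) {i : ι} (hi : (i ∈ α ∧ i ∉ β ∧ i ∉ γ) ∨ (i ∉ α ∧ i ∈ β ∧ i ∉ γ) ∨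
      (i ∉ α ∧ i ∉ β ∧ i ∈ γ)) :
    ∫ ω, centredProd ξ r α ω * centredProd ξ r β ω * centredProd ξ r γ ω ∂P = 0 := by
  rw [h.integral_centredProd]
  refine Finset.prod_eq_zero (Finset.mem_univ i) ?_
  have h1 := integral_cast_sub_pow_poissonMeasure (r i) (k := 1) (by norm_num)
  rcases hi with ⟨a, b, c⟩ | ⟨a, b, c⟩ | ⟨a, b, c⟩ <;> simpa [a, b, c] using h1

/-- Orthogonality of the products of centred variables, with at most one further centred factor. -/
lemma IsPoissonFamily.integral_centredProd_of_card_eq (h : IsPoissonFamily P ξ r)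
    {α β γ : Finset ι} (hc : α.card = β.card) (hγ : γ.card ≤ 1) :
    ∫ ω, centredProd ξ r α ω * centredProd ξ r β ω * centredProd ξ r γ ω ∂P =
      if α = β ∧ γ ⊆ α then ∏ i ∈ α, (r i : ℝ) else 0 := by
  split_ifs with hif
  · obtain ⟨rfl, hγα⟩ := hif
    exact h.integral_centredProd_mul_self α hγα
  · by_cases hαβ : α = β
    · subst hαβ
      obtain ⟨i, hi, hi'⟩ := Finset.not_subset.1 fun h' => hif ⟨rfl, h'⟩
      exact h.integral_centredProd_eq_zero α α γ (i := i) (by tauto)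
    · obtain ⟨j, hj⟩ | hj : (∃ j, γ = {j}) ∨ γ = ∅ := by
        rcases Nat.le_one_iff_eq_zero_or_eq_one.1 hγ with h0 | h1
        · exact Or.inr (Finset.card_eq_zero.1 h0)
        · exact Or.inl (Finset.card_eq_one.1 h1)
      -- The extra factor can repair only the index `j`; another index keeps a lone centred factor,
      -- of mean zero.
      · obtain ⟨i, hij, hi⟩ := exists_mem_notMem_ne hc hαβ j
        have : i ∉ γ := by simpa [hj] using hij
        exact h.integral_centredProd_eq_zero α β γ (i := i) (by tauto)
      · have : ∃ i, (i ∈ α ∧ i ∉ β) ∨ (i ∉ α ∧ i ∈ β) := by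
          by_contra! hcon
          exact hαβ (Finset.ext fun i => ⟨fun hi => (hcon i).1 hi,
            fun hi => by_contra fun h' => (hcon i).2 h' hi⟩)
        obtain ⟨i, hi⟩ := this
        have : i ∉ γ := by simp [hj]
        exact h.integral_centredProd_eq_zero α β γ (i := i) (by tauto)

end IndependentPoisson

/-! ### Second moments of chaos sums, weighted by counts. -/

section ChaosSum

variable {Ω ι : Type*} {mΩ : MeasurableSpace Ω} [Fintype ι] [DecidableEq ι] {P : Measure Ω}
  {ξ : ι → Ω → ℝ} {r : ι → ℝ≥0}

/-- A homogeneous polynomial of degree `n` in the centred variables, without repetitions. -/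
noncomputable def chaosSum (ξ : ι → Ω → ℝ) (r : ι → ℝ≥0) (n : ℕ) (c : Finset ι → ℂ) (ω : Ω) : ℂ :=
  ∑ α ∈ Finset.powersetCard n Finset.univ, c α * centredProd ξ r α ω

omit [DecidableEq ι] in
lemma norm_chaosSum_sq (n : ℕ) (c : Finset ι → ℂ) (ω : Ω) :
    ‖chaosSum ξ r n c ω‖ ^ 2 =
      ∑ α ∈ Finset.powersetCard n Finset.univ, ∑ β ∈ Finset.powersetCard n Finset.univ,
        (c α * (starRingEnd ℂ) (c β)).re * (centredProd ξ r α ω * centredProd ξ r β ω) := by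
  have h : ((‖chaosSum ξ r n c ω‖ ^ 2 : ℝ) : ℂ) =
      ∑ α ∈ Finset.powersetCard n Finset.univ, ∑ β ∈ Finset.powersetCard n Finset.univ,
        (c α * (starRingEnd ℂ) (c β)) *
          ((centredProd ξ r α ω * centredProd ξ r β ω : ℝ) : ℂ) := by
    push_cast
    rw [← Complex.mul_conj', chaosSum, map_sum, Finset.sum_mul_sum]
    refine Finset.sum_congr rfl fun α _ => Finset.sum_congr rfl fun β _ => ?_
    rw [map_mul, Complex.conj_ofReal]
    ring
  have h' := congrArg Complex.re h
  simpa only [Complex.ofReal_re, Complex.re_sum, Complex.re_mul_ofReal] using h'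

omit [DecidableEq ι] in
lemma norm_chaosSum_sq_mul (n : ℕ) (c : Finset ι → ℂ) (γ : Finset ι) (ω : Ω) :
    ‖chaosSum ξ r n c ω‖ ^ 2 * centredProd ξ r γ ω =
      ∑ α ∈ Finset.powersetCard n Finset.univ, ∑ β ∈ Finset.powersetCard n Finset.univ,
        (c α * (starRingEnd ℂ) (c β)).re *
          (centredProd ξ r α ω * centredProd ξ r β ω * centredProd ξ r γ ω) := by
  rw [norm_chaosSum_sq]
  simp_rw [Finset.sum_mul, mul_assoc]

lemma IsPoissonFamily.integrable_norm_chaosSum_sq_mul (h : IsPoissonFamily P ξ r) (n : ℕ)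
    (c : Finset ι → ℂ) (γ : Finset ι) :
    Integrable (fun ω => ‖chaosSum ξ r n c ω‖ ^ 2 * centredProd ξ r γ ω) P := by
  simp_rw [norm_chaosSum_sq_mul]
  exact integrable_finsetSum _ fun α _ => integrable_finsetSum _ fun β _ =>
    (h.integrable_centredProd α β γ).const_mul _

/-- Only the diagonal `α = β` survives. With `γ = {j}` this gives the weight of the terms that
contain `j`, which is what makes the excess a count of indices. -/
lemma IsPoissonFamily.integral_norm_chaosSum_sq_mul (h : IsPoissonFamily P ξ r) (n : ℕ)
    (c : Finset ι → ℂ) {γ : Finset ι} (hγ : γ.card ≤ 1) :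
    ∫ ω, ‖chaosSum ξ r n c ω‖ ^ 2 * centredProd ξ r γ ω ∂P =
      ∑ α ∈ Finset.powersetCard n Finset.univ,
        if γ ⊆ α then ‖c α‖ ^ 2 * ∏ i ∈ α, (r i : ℝ) else 0 := by
  simp_rw [norm_chaosSum_sq_mul]
  rw [integral_finsetSum _ fun α _ => integrable_finsetSum _ fun β _ =>
    (h.integrable_centredProd α β γ).const_mul _]
  refine Finset.sum_congr rfl fun α hα => ?_
  rw [integral_finsetSum _ fun β _ => (h.integrable_centredProd α β γ).const_mul _]
  rw [Finset.sum_eq_single_of_mem α hα]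
  · rw [integral_const_mul, h.integral_centredProd_of_card_eq rfl hγ, Complex.mul_conj']
    norm_cast
    split_ifs with h1 h2 h2
    · rfl
    · exact absurd h1.2 h2
    · exact absurd ⟨rfl, h2⟩ h1
    · simp
  · intro β hβ hne
    rw [integral_const_mul, h.integral_centredProd_of_card_eq _ hγ, if_neg, mul_zero]
    · exact fun h' => hne h'.1.symm
    · rw [(Finset.mem_powersetCard.1 hα).2, (Finset.mem_powersetCard.1 hβ).2]

lemma IsPoissonFamily.integrable_norm_chaosSum_sq (h : IsPoissonFamily P ξ r) (n : ℕ)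
    (c : Finset ι → ℂ) : Integrable (fun ω => ‖chaosSum ξ r n c ω‖ ^ 2) P := by
  simpa [centredProd] using h.integrable_norm_chaosSum_sq_mul n c ∅

/-- The second moment of a chaos sum, weighted by the variable `∑ j ∈ J, ξ j`. -/
lemma IsPoissonFamily.integral_norm_chaosSum_sq_mul_sum (h : IsPoissonFamily P ξ r) (n : ℕ)
    (c : Finset ι → ℂ) (J : Finset ι) :
    Integrable (fun ω => ‖chaosSum ξ r n c ω‖ ^ 2 * ∑ j ∈ J, ξ j ω) P ∧
    ∫ ω, ‖chaosSum ξ r n c ω‖ ^ 2 * ∑ j ∈ J, ξ j ω ∂P =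
      (∑ j ∈ J, (r j : ℝ)) * ∫ ω, ‖chaosSum ξ r n c ω‖ ^ 2 ∂P +
      ∑ α ∈ Finset.powersetCard n Finset.univ,
        ((α ∩ J).card : ℝ) * (‖c α‖ ^ 2 * ∏ i ∈ α, (r i : ℝ)) := by
  have h1 : ∀ ω, ‖chaosSum ξ r n c ω‖ ^ 2 * ∑ j ∈ J, ξ j ω =
      (∑ j ∈ J, (r j : ℝ)) * ‖chaosSum ξ r n c ω‖ ^ 2 +
        ∑ j ∈ J, ‖chaosSum ξ r n c ω‖ ^ 2 * centredProd ξ r {j} ω := fun ω => by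
    simp only [centredProd, Finset.prod_singleton]
    rw [← Finset.mul_sum, Finset.sum_sub_distrib]
    ring
  simp_rw [h1]
  have h2 := (h.integrable_norm_chaosSum_sq n c).const_mul (∑ j ∈ J, (r j : ℝ))
  have h3 : Integrable (fun ω => ∑ j ∈ J, ‖chaosSum ξ r n c ω‖ ^ 2 * centredProd ξ r {j} ω) P :=
    integrable_finsetSum _ fun j _ => h.integrable_norm_chaosSum_sq_mul n c {j}
  refine ⟨h2.add h3, ?_⟩
  rw [integral_add h2 h3, integral_const_mul,
    integral_finsetSum _ fun j _ => h.integrable_norm_chaosSum_sq_mul n c {j}]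
  congr 1
  simp_rw [h.integral_norm_chaosSum_sq_mul n c (Finset.card_singleton _).le,
    Finset.singleton_subset_iff]
  rw [Finset.sum_comm]
  refine Finset.sum_congr rfl fun α _ => ?_
  rw [← Finset.sum_filter, Finset.sum_const, nsmul_eq_mul, Finset.filter_mem_eq_inter,
    Finset.inter_comm]

lemma IsPoissonFamily.integral_norm_chaosSum_sq (h : IsPoissonFamily P ξ r) (n : ℕ)
    (c : Finset ι → ℂ) :
    ∫ ω, ‖chaosSum ξ r n c ω‖ ^ 2 ∂P =
      ∑ α ∈ Finset.powersetCard n Finset.univ, ‖c α‖ ^ 2 * ∏ i ∈ α, (r i : ℝ) := by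
  simpa [centredProd] using h.integral_norm_chaosSum_sq_mul n c (γ := ∅) (by simp)

/-- The excess weights the term of `α` by the cardinality of `α ∩ J`. This lies between `0` and `n`,
and equals `n` when `J` is everything: hence this bound and the two statements after it. -/
lemma IsPoissonFamily.le_integral_norm_chaosSum_sq_mul_sum (h : IsPoissonFamily P ξ r) (n : ℕ)
    (c : Finset ι → ℂ) (J : Finset ι) :
    (∑ j ∈ J, (r j : ℝ)) * ∫ ω, ‖chaosSum ξ r n c ω‖ ^ 2 ∂P ≤
      ∫ ω, ‖chaosSum ξ r n c ω‖ ^ 2 * ∑ j ∈ J, ξ j ω ∂P := by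
  rw [(h.integral_norm_chaosSum_sq_mul_sum n c J).2]
  exact le_add_of_nonneg_right (Finset.sum_nonneg fun α _ => by positivity)

lemma IsPoissonFamily.integral_norm_chaosSum_sq_mul_sum_le (h : IsPoissonFamily P ξ r) (n : ℕ)
    (c : Finset ι → ℂ) (J : Finset ι) :
    ∫ ω, ‖chaosSum ξ r n c ω‖ ^ 2 * ∑ j ∈ J, ξ j ω ∂P ≤
      (∑ j ∈ J, (r j : ℝ) + n) * ∫ ω, ‖chaosSum ξ r n c ω‖ ^ 2 ∂P := by
  rw [(h.integral_norm_chaosSum_sq_mul_sum n c J).2, add_mul, add_le_add_iff_left,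
    h.integral_norm_chaosSum_sq, Finset.mul_sum]
  refine Finset.sum_le_sum fun α hα => mul_le_mul_of_nonneg_right ?_ (by positivity)
  rw [← (Finset.mem_powersetCard.1 hα).2]
  exact_mod_cast Finset.card_le_card Finset.inter_subset_left

lemma IsPoissonFamily.integral_norm_chaosSum_sq_mul_sum_univ (h : IsPoissonFamily P ξ r) (n : ℕ)
    (c : Finset ι → ℂ) :
    ∫ ω, ‖chaosSum ξ r n c ω‖ ^ 2 * ∑ j, ξ j ω ∂P =
      (∑ j, (r j : ℝ) + n) * ∫ ω, ‖chaosSum ξ r n c ω‖ ^ 2 ∂P := by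
  rw [(h.integral_norm_chaosSum_sq_mul_sum n c Finset.univ).2, add_mul, add_right_inj,
    h.integral_norm_chaosSum_sq, Finset.mul_sum]
  refine Finset.sum_congr rfl fun α hα => ?_
  rw [Finset.inter_univ, (Finset.mem_powersetCard.1 hα).2]

end ChaosSum

/-! ### Approximating exponentials of Poisson variables by affine functions. -/

section Exponentials

variable {Ω ι : Type*} {mΩ : MeasurableSpace Ω} [Fintype ι] {P : Measure Ω}
  {ξ : ι → Ω → ℝ} {r : ι → ℝ≥0}

lemma integral_cexp_poissonMeasure (r : ℝ≥0) (θ : ℝ) (k : ℕ) :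
    Integrable (fun n : ℕ => (n.descFactorial k : ℂ) * Complex.exp (θ * (n : ℝ) * Complex.I))
      (poissonMeasure r) ∧
    ∫ n : ℕ, (n.descFactorial k : ℂ) * Complex.exp (θ * (n : ℝ) * Complex.I) ∂poissonMeasure r =
      (r * Complex.exp (θ * Complex.I)) ^ k *
        Complex.exp (r * (Complex.exp (θ * Complex.I) - 1)) := by
  have h : ∀ n : ℕ, Complex.exp (θ * (n : ℝ) * Complex.I) = Complex.exp (θ * Complex.I) ^ n :=
    fun n => by
      rw [← Complex.exp_nat_mul]
      push_cast
      ring_nf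
  simp_rw [h]
  exact ⟨integrable_descFactorial_mul_pow_poissonMeasure _ _ _,
    integral_descFactorial_mul_pow_poissonMeasure _ _ _⟩

/-- The affine approximation of `exp (θ u i)` in the first chaos, for a Poisson variable. -/
noncomputable def affineExp (r : ℝ≥0) (θ u : ℝ) : ℂ :=
  Complex.exp (r * (Complex.exp (θ * Complex.I) - 1)) *
    (1 + (Complex.exp (θ * Complex.I) - 1) * ((u - r : ℝ) : ℂ))

lemma norm_exp_mul_I_sub_one_sq (θ : ℝ) :
    ‖Complex.exp (θ * Complex.I) - 1‖ ^ 2 = -2 * (Complex.exp (θ * Complex.I) - 1).re := by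
  have h : (Complex.exp (θ * Complex.I)).re ^ 2 + (Complex.exp (θ * Complex.I)).im ^ 2 = 1 := by
    rw [Complex.exp_ofReal_mul_I_re, Complex.exp_ofReal_mul_I_im]
    exact Real.cos_sq_add_sin_sq θ
  rw [← Complex.normSq_eq_norm_sq, Complex.normSq_apply, Complex.sub_re, Complex.sub_im,
    Complex.one_re, Complex.one_im]
  linarith

/-- The inner product of `exp (θ u i)` with its affine approximation, for a Poisson variable. -/
noncomputable def affineExpOverlap (r : ℝ≥0) (θ : ℝ) : ℝ :=
  Real.exp (-(r * ‖Complex.exp (θ * Complex.I) - 1‖ ^ 2)) *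
    (1 + r * ‖Complex.exp (θ * Complex.I) - 1‖ ^ 2)

lemma exp_add_conj_eq (r : ℝ≥0) (θ : ℝ) :
    Complex.exp (r * (Complex.exp (θ * Complex.I) - 1)) *
      (starRingEnd ℂ) (Complex.exp (r * (Complex.exp (θ * Complex.I) - 1))) =
    (Real.exp (-(r * ‖Complex.exp (θ * Complex.I) - 1‖ ^ 2)) : ℝ) := by
  rw [Complex.mul_conj', Complex.norm_exp, ← Complex.ofReal_pow, ← Real.exp_nat_mul,
    norm_exp_mul_I_sub_one_sq]
  congr 2
  rw [Complex.re_ofReal_mul]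
  push_cast
  ring

lemma integral_affineExp_mul_conj (r : ℝ≥0) (θ : ℝ) :
    Integrable (fun n : ℕ => affineExp r θ n * (starRingEnd ℂ) (affineExp r θ n))
      (poissonMeasure r) ∧
    ∫ n : ℕ, affineExp r θ n * (starRingEnd ℂ) (affineExp r θ n) ∂poissonMeasure r =
      affineExpOverlap r θ := by
  set t := Complex.exp (θ * Complex.I) - 1 with ht
  set E := Complex.exp (r * t) with hE
  have h : ∀ n : ℕ, affineExp r θ n * (starRingEnd ℂ) (affineExp r θ n) =
      (E * (starRingEnd ℂ) E) * (((((n : ℝ) - r) ^ 0 : ℝ) : ℂ) +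
        (t + (starRingEnd ℂ) t) * ((((n : ℝ) - r) ^ 1 : ℝ) : ℂ) +
        (t * (starRingEnd ℂ) t) * ((((n : ℝ) - r) ^ 2 : ℝ) : ℂ)) := fun n => by
    rw [affineExp, ← ht, ← hE]
    simp only [map_mul, map_add, map_one, Complex.conj_ofReal]
    push_cast
    ring
  have hi : ∀ k ≤ 3, Integrable (fun n : ℕ => ((((n : ℝ) - r) ^ k : ℝ) : ℂ)) (poissonMeasure r) :=
    fun k hk => (integrable_cast_sub_pow_poissonMeasure r hk).ofReal
  have hm := fun k hk => integral_cast_sub_pow_poissonMeasure r (k := k) hk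
  have h0 := hi 0 (by norm_num)
  have h1 := (hi 1 (by norm_num)).const_mul (t + (starRingEnd ℂ) t)
  have h2 := (hi 2 (by norm_num)).const_mul (t * (starRingEnd ℂ) t)
  have h01 : Integrable (fun n : ℕ => ((((n : ℝ) - r) ^ 0 : ℝ) : ℂ) +
      (t + (starRingEnd ℂ) t) * ((((n : ℝ) - r) ^ 1 : ℝ) : ℂ)) (poissonMeasure r) := h0.add h1
  simp_rw [h]
  refine ⟨(h01.add h2).const_mul _, ?_⟩
  rw [integral_const_mul, integral_add h01 h2, integral_add h0 h1, integral_const_mul,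
    integral_const_mul, integral_complex_ofReal, integral_complex_ofReal, integral_complex_ofReal,
    hm 0 (by norm_num), hm 1 (by norm_num), hm 2 (by norm_num), hE, ht, exp_add_conj_eq, ← ht,
    Complex.mul_conj', affineExpOverlap, ← ht]
  simp
  ring

/-- The value is the squared norm of the affine function found above: `affineExp` is the orthogonal
projection of the exponential onto the span of `1` and `ξ - r`. -/
lemma integral_exp_mul_conj_affineExp (r : ℝ≥0) (θ : ℝ) :
    Integrable (fun n : ℕ => Complex.exp (θ * (n : ℝ) * Complex.I) *
      (starRingEnd ℂ) (affineExp r θ n)) (poissonMeasure r) ∧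
    ∫ n : ℕ, Complex.exp (θ * (n : ℝ) * Complex.I) * (starRingEnd ℂ) (affineExp r θ n)
      ∂poissonMeasure r = affineExpOverlap r θ := by
  obtain ⟨h0, h0'⟩ := integral_cexp_poissonMeasure r θ 0
  obtain ⟨h1, h1'⟩ := integral_cexp_poissonMeasure r θ 1
  set t := Complex.exp (θ * Complex.I) - 1 with ht
  set E := Complex.exp (r * t) with hE
  have h : ∀ n : ℕ, Complex.exp (θ * (n : ℝ) * Complex.I) * (starRingEnd ℂ) (affineExp r θ n) =
      (starRingEnd ℂ) E * ((1 - (starRingEnd ℂ) t * r) *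
          ((n.descFactorial 0 : ℂ) * Complex.exp (θ * (n : ℝ) * Complex.I)) +
        (starRingEnd ℂ) t *
          ((n.descFactorial 1 : ℂ) * Complex.exp (θ * (n : ℝ) * Complex.I))) := fun n => by
    rw [affineExp, ← ht, ← hE]
    simp only [map_mul, map_add, map_one, Complex.conj_ofReal]
    simp
    ring
  simp_rw [h]
  refine ⟨((h0.const_mul _).add (h1.const_mul _)).const_mul _, ?_⟩
  rw [integral_const_mul, integral_add (h0.const_mul _) (h1.const_mul _), integral_const_mul,
    integral_const_mul, h0', h1', affineExpOverlap, Complex.ofReal_mul, ← exp_add_conj_eq, ← ht,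
    ← hE]
  have h3 : (starRingEnd ℂ) t * t = ((‖t‖ ^ 2 : ℝ) : ℂ) := by
    rw [mul_comm, Complex.mul_conj']
    norm_cast
  have h4 : Complex.exp (θ * Complex.I) = t + 1 := by rw [ht]; ring
  push_cast at h3 ⊢
  rw [h4, ← h3]
  ring

/-- With `a = r |exp(iθ) - 1|² ≤ 4r`, the overlap is `exp(-a) (1 + a) ≥ 1 - a²`. The loss is
quadratic in `r`, so it sums to something small over many small atoms. -/
lemma one_sub_le_affineExpOverlap (r : ℝ≥0) (θ : ℝ) :
    0 ≤ affineExpOverlap r θ ∧ affineExpOverlap r θ ≤ 1 ∧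
      1 - 16 * (r : ℝ) ^ 2 ≤ affineExpOverlap r θ := by
  rw [affineExpOverlap]
  have ht : ‖Complex.exp (θ * Complex.I) - 1‖ ≤ 2 := by
    refine (norm_sub_le _ _).trans ?_
    rw [Complex.norm_exp_ofReal_mul_I, norm_one]
    norm_num
  set a := (r : ℝ) * ‖Complex.exp (θ * Complex.I) - 1‖ ^ 2 with ha
  have ha0 : 0 ≤ a := by positivity
  have ha4 : a ≤ 4 * r := by
    have : ‖Complex.exp (θ * Complex.I) - 1‖ ^ 2 ≤ 2 ^ 2 := by gcongr
    nlinarith [r.2]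
  refine ⟨by positivity, ?_, ?_⟩
  · rw [Real.exp_neg, inv_mul_le_one₀ (Real.exp_pos a), add_comm]
    exact Real.add_one_le_exp a
  · have h1 : 1 - a ≤ Real.exp (-a) := by
      have := Real.add_one_le_exp (-a)
      linarith
    have h2 : (1 - a) * (1 + a) ≤ Real.exp (-a) * (1 + a) := by gcongr
    nlinarith

lemma one_sub_sum_le_prod {κ : Type*} (s : Finset κ) (a b : κ → ℝ)
    (h : ∀ i ∈ s, 0 ≤ a i ∧ a i ≤ 1 ∧ 1 - b i ≤ a i) :
    1 - ∑ i ∈ s, b i ≤ ∏ i ∈ s, a i := by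
  classical
  induction s using Finset.induction_on with
  | empty => simp
  | insert i s hi ih =>
    rw [Finset.sum_insert hi, Finset.prod_insert hi]
    have h1 := ih fun j hj => h j (Finset.mem_insert_of_mem hj)
    obtain ⟨h2, h3, h4⟩ := h i (Finset.mem_insert_self i s)
    have h5 : ∏ j ∈ s, a j ≤ 1 := Finset.prod_le_one
      (fun j hj => (h j (Finset.mem_insert_of_mem hj)).1)
      (fun j hj => (h j (Finset.mem_insert_of_mem hj)).2.1)
    nlinarith

/-- The exponential of a linear combination of independent Poisson variables of small parameters is
close to the product of the affine approximations. -/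
lemma IsPoissonFamily.integral_norm_exp_sub_prod_sq_le (h : IsPoissonFamily P ξ r) (θ : ι → ℝ) :
    Integrable (fun ω => ‖Complex.exp ((∑ i, θ i * ξ i ω : ℝ) * Complex.I) -
      ∏ i, affineExp (r i) (θ i) (ξ i ω)‖ ^ 2) P ∧
    ∫ ω, ‖Complex.exp ((∑ i, θ i * ξ i ω : ℝ) * Complex.I) -
      ∏ i, affineExp (r i) (θ i) (ξ i ω)‖ ^ 2 ∂P ≤ 16 * ∑ i, (r i : ℝ) ^ 2 := by
  have := h.indep.isProbabilityMeasure
  set φ : ι → ℝ → ℂ := fun i u => Complex.exp (θ i * u * Complex.I) with hφ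
  set ψ : ι → ℝ → ℂ := fun i u => affineExp (r i) (θ i) u with hψ
  have hφm : ∀ i, Measurable (φ i) := fun i => by fun_prop
  have hψm : ∀ i, Measurable (ψ i) := fun i => by
    simp only [hψ]
    unfold affineExp
    fun_prop
  have hcm := fun i => Complex.continuous_conj.measurable.comp (hψm i)
  have hexp : ∀ ω, Complex.exp ((∑ i, θ i * ξ i ω : ℝ) * Complex.I) = ∏ i, φ i (ξ i ω) := fun ω => by
    rw [← Complex.exp_sum, ← Finset.sum_mul]
    push_cast
    rfl
  have hZ1 := h.integrable_prod (φ := fun i u => ψ i u * (starRingEnd ℂ) (ψ i u))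
    (fun i => (hψm i).mul (hcm i)) fun i => (integral_affineExp_mul_conj (r i) (θ i)).1
  have hZ2 := h.integral_prod (φ := fun i u => ψ i u * (starRingEnd ℂ) (ψ i u))
    (fun i => (hψm i).mul (hcm i))
  have hW1 := h.integrable_prod (φ := fun i u => φ i u * (starRingEnd ℂ) (ψ i u))
    (fun i => (hφm i).mul (hcm i)) fun i => (integral_exp_mul_conj_affineExp (r i) (θ i)).1
  have hW2 := h.integral_prod (φ := fun i u => φ i u * (starRingEnd ℂ) (ψ i u))
    (fun i => (hφm i).mul (hcm i))
  simp_rw [hψ, fun i => (integral_affineExp_mul_conj (r i) (θ i)).2] at hZ2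
  simp_rw [hφ, hψ, fun i => (integral_exp_mul_conj_affineExp (r i) (θ i)).2] at hW2
  -- The exponential has modulus one, and both remaining expectations equal the product `p` of the
  -- overlaps; the squared distance is thus `1 + p - 2p = 1 - p`.
  have hsq : ∀ ω, ‖Complex.exp ((∑ i, θ i * ξ i ω : ℝ) * Complex.I) -
      ∏ i, affineExp (r i) (θ i) (ξ i ω)‖ ^ 2 =
      1 + (∏ i, ψ i (ξ i ω) * (starRingEnd ℂ) (ψ i (ξ i ω))).re -
        2 * (∏ i, φ i (ξ i ω) * (starRingEnd ℂ) (ψ i (ξ i ω))).re := fun ω => by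
    have h1 : ‖Complex.exp ((∑ i, θ i * ξ i ω : ℝ) * Complex.I)‖ = 1 :=
      Complex.norm_exp_ofReal_mul_I _
    rw [Finset.prod_mul_distrib, Finset.prod_mul_distrib, ← map_prod, ← hexp, Complex.mul_conj',
      ← Complex.normSq_eq_norm_sq, Complex.normSq_sub, Complex.normSq_eq_norm_sq, h1,
      Complex.normSq_eq_norm_sq]
    norm_cast
    ring
  simp_rw [hsq]
  have hZ3 : Integrable (fun ω => 1 + (∏ i, ψ i (ξ i ω) * (starRingEnd ℂ) (ψ i (ξ i ω))).re) P :=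
    (integrable_const 1).add hZ1.re
  have hW3 : Integrable (fun ω => 2 * (∏ i, φ i (ξ i ω) * (starRingEnd ℂ) (ψ i (ξ i ω))).re) P :=
    hW1.re.const_mul 2
  refine ⟨hZ3.sub hW3, ?_⟩
  have hZ4 : ∫ ω, (∏ i, ψ i (ξ i ω) * (starRingEnd ℂ) (ψ i (ξ i ω))).re ∂P =
      ∏ i, affineExpOverlap (r i) (θ i) := by
    refine (integral_re hZ1).trans ?_
    rw [hZ2]
    norm_cast
  have hW4 : ∫ ω, (∏ i, φ i (ξ i ω) * (starRingEnd ℂ) (ψ i (ξ i ω))).re ∂P =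
      ∏ i, affineExpOverlap (r i) (θ i) := by
    refine (integral_re hW1).trans ?_
    rw [hW2]
    norm_cast
  have hZ5 : Integrable (fun ω => (∏ i, ψ i (ξ i ω) * (starRingEnd ℂ) (ψ i (ξ i ω))).re) P :=
    hZ1.re
  rw [integral_sub hZ3 hW3, integral_add (integrable_const 1) hZ5, integral_const_mul, hZ4, hW4]
  have := one_sub_sum_le_prod Finset.univ (fun i => affineExpOverlap (r i) (θ i))
    (fun i => 16 * (r i : ℝ) ^ 2) fun i _ => one_sub_le_affineExpOverlap (r i) (θ i)
  rw [← Finset.mul_sum] at this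
  simp only [integral_const, probReal_univ, smul_eq_mul, mul_one]
  linarith

end Exponentials

section

variable {X : Type*} [MeasurableSpace X] {μ : Measure X}

/-! ### Counts of sets of finite measure. -/

section Counts

lemma measurable_N {A : Set X} (hA : MeasurableSet A) : Measurable (N A) := by
  rw [measurable_iff_comap_le, BorelSpace.measurable_eq (α := ℝ≥0∞)]
  exact le_iSup₂ (f := fun (A : Set X) (_ : MeasurableSet A) => (borel ℝ≥0∞).comap (N A)) A hA

/-- The number of points in `A`, as a real number. -/
noncomputable def count (A : Set X) (ν : CountingMeasure X) : ℝ := (N A ν).toReal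

lemma measurable_count {A : Set X} (hA : MeasurableSet A) : Measurable (count A) :=
  (measurable_N hA).ennreal_toReal

lemma N_union {A B : Set X} (h : Disjoint A B) (hB : MeasurableSet B) (ν : CountingMeasure X) :
    N (A ∪ B) ν = N A ν + N B ν :=
  measure_union h hB

lemma N_biUnion {κ : Type*} (s : Finset κ) {B : κ → Set X}
    (hd : Pairwise fun i j => Disjoint (B i) (B j)) (hB : ∀ i, MeasurableSet (B i))
    (ν : CountingMeasure X) : N (⋃ i ∈ s, B i) ν = ∑ i ∈ s, N (B i) ν :=
  measure_biUnion_finset (fun _ _ _ _ h => hd h) fun i _ => hB i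

variable {P : Measure (CountingMeasure X)}

lemma IsPoisson.lintegral_N (hP : IsPoisson μ P) {A : Set X} (hA : MeasurableSet A)
    (h0 : 0 < μ A) (h1 : μ A < ∞) : ∫⁻ ν, N A ν ∂P = μ A := by
  have h := (hP 1 (fun _ => A) (fun _ => hA) (fun _ => h0) (fun _ => h1)
    (fun i j hij => absurd (Subsingleton.elim i j) hij)).2 0
  have h2 : ∫⁻ u, u ∂P.map (N A) = μ A := by
    rw [h, lintegral_map (f := fun u : ℝ≥0∞ => u) measurable_id .of_discrete]
    have hi := integrable_descFactorial_poissonMeasure (μ A).toNNReal 1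
    have hv := integral_descFactorial_poissonMeasure (μ A).toNNReal 1
    simp only [Nat.descFactorial_one, pow_one] at hi hv
    have := ofReal_integral_eq_lintegral_ofReal hi (Filter.Eventually.of_forall fun n => by positivity)
    rw [hv, ENNReal.ofReal_coe_nnreal, ENNReal.coe_toNNReal h1.ne] at this
    refine Eq.trans (lintegral_congr fun n => ?_) this.symm
    simp
  rwa [lintegral_map (f := fun u : ℝ≥0∞ => u) measurable_id (measurable_N hA)] at h2

lemma exists_measurableSet_pos_lt_top [SigmaFinite μ] (hinf : μ Set.univ = ∞) {B : Set X}
    (hB : MeasurableSet B) (h0 : μ B = 0) :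
    ∃ A, MeasurableSet A ∧ Disjoint A B ∧ 0 < μ A ∧ μ A < ∞ := by
  by_contra! hcon
  have h : ∀ n, μ (spanningSets μ n) = 0 := fun n => by
    by_contra hne
    have h1 : μ (spanningSets μ n \ B) = μ (spanningSets μ n) := measure_sdiff_null h0
    have := hcon (spanningSets μ n \ B) ((measurableSet_spanningSets μ n).diff hB)
      Set.disjoint_sdiff_left (h1 ▸ pos_iff_ne_zero.2 hne)
    rw [h1] at this
    exact absurd (measure_spanningSets_lt_top μ n) (not_lt.2 this)
  have h2 := measure_iUnion_null h
  rw [iUnion_spanningSets, hinf] at h2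
  exact ENNReal.top_ne_zero h2

variable [SigmaFinite μ]

/-- `IsPoisson` says nothing directly about null sets. Adjoining `B` to a disjoint set of positive
finite measure, which exists as `μ` has infinite mass, does not change the mean count, so `N B` has
mean zero. -/
lemma IsPoisson.N_ae_eq_zero (hP : IsPoisson μ P) (hinf : μ Set.univ = ∞) {B : Set X}
    (hB : MeasurableSet B) (h0 : μ B = 0) : N B =ᵐ[P] 0 := by
  obtain ⟨A, hA, hd, hA0, hA1⟩ := exists_measurableSet_pos_lt_top hinf hB h0
  have h1 : μ (A ∪ B) = μ A := by
    rw [measure_union hd hB, h0, add_zero]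
  have h2 := hP.lintegral_N (hA.union hB) (h1 ▸ hA0) (h1 ▸ hA1)
  simp_rw [N_union hd hB] at h2
  rw [lintegral_add_left (measurable_N hA), hP.lintegral_N hA hA0 hA1, h1] at h2
  have h3 : ∫⁻ ν, N B ν ∂P = 0 := by
    have : μ A + ∫⁻ ν, N B ν ∂P = μ A + 0 := by rw [h2, add_zero]
    exact (ENNReal.add_right_inj hA1.ne).1 this
  exact (lintegral_eq_zero_iff (measurable_N hB)).1 h3

lemma IsPoisson.lintegral_N_eq (hP : IsPoisson μ P) (hinf : μ Set.univ = ∞) {A : Set X}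
    (hA : MeasurableSet A) (h1 : μ A < ∞) : ∫⁻ ν, N A ν ∂P = μ A := by
  rcases eq_or_ne (μ A) 0 with h0 | h0
  · rw [lintegral_congr_ae (hP.N_ae_eq_zero hinf hA h0), h0]
    simp
  · exact hP.lintegral_N hA (pos_iff_ne_zero.2 h0) h1

lemma IsPoisson.ae_N_lt_top (hP : IsPoisson μ P) (hinf : μ Set.univ = ∞) {A : Set X}
    (hA : MeasurableSet A) (h1 : μ A < ∞) : ∀ᵐ ν ∂P, N A ν < ∞ :=
  ae_lt_top (measurable_N hA) (by rw [hP.lintegral_N_eq hinf hA h1]; exact h1.ne)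

lemma IsPoisson.integrable_count (hP : IsPoisson μ P) (hinf : μ Set.univ = ∞) {A : Set X}
    (hA : MeasurableSet A) (h1 : μ A < ∞) :
    Integrable (count A) P ∧ ∫ ν, count A ν ∂P = (μ A).toReal := by
  have h := hP.lintegral_N_eq hinf hA h1
  refine ⟨integrable_toReal_of_lintegral_ne_top (measurable_N hA).aemeasurable
    (by rw [h]; exact h1.ne), ?_⟩
  unfold count
  rw [integral_toReal (measurable_N hA).aemeasurable (hP.ae_N_lt_top hinf hA h1), h]

end Counts

/-! ### Atoms of a finite family of sets, and their independent counts. -/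

section Atoms

open Classical in
/-- The atoms of the algebra of sets generated by `T`. -/
def atom (T : Finset (Set X)) (σ : Finset (Set X)) : Set X := {x | {A ∈ T | x ∈ A} = σ}

omit [MeasurableSpace X] in
lemma pairwise_disjoint_atom (T : Finset (Set X)) :
    Pairwise fun σ τ => Disjoint (atom T σ) (atom T τ) := fun _ _ h =>
  Set.disjoint_left.2 fun _ hσ hτ => h (hσ.symm.trans hτ)

omit [MeasurableSpace X] in
lemma mem_of_mem_atom {T σ : Finset (Set X)} {x : X} (hx : x ∈ atom T σ) {A : Set X} (hA : A ∈ T) :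
    A ∈ σ ↔ x ∈ A := by
  classical
  have hx' : ({A ∈ T | x ∈ A} : Finset (Set X)) = σ := by
    rw [← hx]
  rw [← hx', Finset.mem_filter]
  exact ⟨fun h => h.2, fun h => ⟨hA, h⟩⟩

lemma measurableSet_atom {T : Finset (Set X)} (hT : ∀ A ∈ T, MeasurableSet A)
    (σ : Finset (Set X)) : MeasurableSet (atom T σ) := by
  classical
  by_cases hσ : σ ⊆ T
  · have : atom T σ = ⋂ A ∈ T, {x | A ∈ σ ↔ x ∈ A} := by
      ext x
      simp only [Set.mem_iInter, Set.mem_ofPred_eq]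
      refine ⟨fun hx A hA => mem_of_mem_atom hx hA, fun hx => Finset.ext fun A => ?_⟩
      rw [Finset.mem_filter]
      exact ⟨fun h => (hx A h.1).2 h.2, fun h => ⟨hσ h, (hx A (hσ h)).1 h⟩⟩
    rw [this]
    refine Finset.measurableSet_biInter _ fun A hA => ?_
    by_cases hAσ : A ∈ σ
    · convert! hT A hA using 1
      ext x
      simp [hAσ]
    · convert! (hT A hA).compl using 1
      ext x
      simp [hAσ]
  · have : atom T σ = ∅ := Set.eq_empty_of_forall_notMem fun x hx =>
      hσ (by rw [← hx]; exact Finset.filter_subset _ _)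
    rw [this]
    exact MeasurableSet.empty

open Classical in
/-- The indices of the atoms of positive measure contained in `⋃ T`. -/
noncomputable def atomIndex (μ : Measure X) (T : Finset (Set X)) : Finset (Finset (Set X)) :=
  -- Nonemptiness of `σ` bounds the atom by a member of `T`, hence gives finite measure; positivity
  -- makes `IsPoisson` applicable.
  {σ ∈ T.powerset | σ.Nonempty ∧ 0 < μ (atom T σ)}

lemma mem_atomIndex {T σ : Finset (Set X)} :
    σ ∈ atomIndex μ T ↔ σ ⊆ T ∧ σ.Nonempty ∧ 0 < μ (atom T σ) := by
  simp [atomIndex]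

omit [MeasurableSpace X] in
lemma atom_subset {T σ : Finset (Set X)} (hσ : σ ⊆ T) {A : Set X} (hA : A ∈ σ) :
    atom T σ ⊆ A := fun _ hx => (mem_of_mem_atom hx (hσ hA)).1 hA

omit [MeasurableSpace X] in
lemma eq_biUnion_atom {T : Finset (Set X)} {A : Set X} (hA : A ∈ T) [DecidableEq (Set X)] :
    A = ⋃ σ ∈ ({σ ∈ T.powerset | A ∈ σ} : Finset (Finset (Set X))), atom T σ := by
  classical
  ext x
  simp only [Set.mem_iUnion, Finset.mem_filter, Finset.mem_powerset, exists_prop]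
  constructor
  · intro hx
    refine ⟨{B ∈ T | x ∈ B}, ⟨Finset.filter_subset _ _, Finset.mem_filter.2 ⟨hA, hx⟩⟩, ?_⟩
    simp only [atom, Set.mem_ofPred_eq]
  · rintro ⟨σ, ⟨hσ, hAσ⟩, hx⟩
    exact atom_subset hσ hAσ hx

/-- A finite family of measurable sets of finite measure. -/
def IsFiniteMeasureFamily (μ : Measure X) (T : Finset (Set X)) : Prop :=
  ∀ A ∈ T, MeasurableSet A ∧ μ A < ∞

variable {T : Finset (Set X)}

lemma IsFiniteMeasureFamily.measurableSet_atom (hT : IsFiniteMeasureFamily μ T)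
    (σ : Finset (Set X)) : MeasurableSet (atom T σ) :=
  PoissonChaos.measurableSet_atom (fun A hA => (hT A hA).1) σ

lemma IsFiniteMeasureFamily.measure_atom_lt_top (hT : IsFiniteMeasureFamily μ T)
    (σ : atomIndex μ T) : μ (atom T σ) < ∞ := by
  obtain ⟨h1, ⟨A, hA⟩, -⟩ := mem_atomIndex.1 σ.2
  exact (measure_mono (atom_subset h1 hA)).trans_lt (hT A (h1 hA)).2

-- Stated for a second measure `ρ` so as to serve both `μ` itself and almost every configuration
-- `ν`, which puts no points into the `μ`-null atoms.
open Classical in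
lemma measure_eq_sum_atom (hT : ∀ A ∈ T, MeasurableSet A) {A : Set X} (hA : A ∈ T)
    {ρ : Measure X} (hρ : ∀ σ, μ (atom T σ) = 0 → ρ (atom T σ) = 0) :
    ρ A = ∑ σ : atomIndex μ T with A ∈ σ.1, ρ (atom T σ) := by
  conv_lhs => rw [eq_biUnion_atom hA]
  rw [measure_biUnion_finset (fun _ _ _ _ h => pairwise_disjoint_atom T h)
    fun σ _ => PoissonChaos.measurableSet_atom hT σ]
  have : ∑ σ : atomIndex μ T with A ∈ σ.1, ρ (atom T σ) =
      ∑ σ ∈ atomIndex μ T with A ∈ σ, ρ (atom T σ) := by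
    rw [Finset.sum_filter, Finset.sum_filter]
    exact Finset.sum_coe_sort (atomIndex μ T) fun σ => if A ∈ σ then ρ (atom T σ) else 0
  rw [this]
  symm
  refine Finset.sum_subset_zero_on_sdiff (fun σ hσ => ?_) (fun σ hσ => ?_) fun _ _ => rfl
  · rw [Finset.mem_filter] at hσ ⊢
    exact ⟨Finset.mem_powerset.2 (mem_atomIndex.1 hσ.1).1, hσ.2⟩
  · rw [Finset.mem_sdiff, Finset.mem_filter, Finset.mem_filter, Finset.mem_powerset] at hσ
    refine hρ σ (by_contra fun hne => hσ.2 ⟨?_, hσ.1.2⟩)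
    exact mem_atomIndex.2 ⟨hσ.1.1, ⟨A, hσ.1.2⟩, pos_iff_ne_zero.2 hne⟩

variable {P : Measure (CountingMeasure X)} [SigmaFinite μ]

open Classical in
lemma IsPoisson.ae_count_eq_sum (hP : IsPoisson μ P) (hinf : μ Set.univ = ∞)
    (hT : IsFiniteMeasureFamily μ T) : ∀ᵐ ν ∂P, ∀ A ∈ T,
      N A ν < ∞ ∧ count A ν = ∑ σ : atomIndex μ T with A ∈ σ.1, count (atom T σ) ν := by
  have h1 : ∀ᵐ ν ∂P, ∀ σ ∈ T.powerset, μ (atom T σ) = 0 → N (atom T σ) ν = 0 := by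
    rw [Filter.eventually_all_finset]
    intro σ _
    by_cases h : μ (atom T σ) = 0
    · filter_upwards [hP.N_ae_eq_zero hinf (hT.measurableSet_atom σ) h] with ν hν _ using hν
    · exact Filter.Eventually.of_forall fun ν h' => absurd h' h
  have h2 : ∀ᵐ ν ∂P, ∀ A ∈ T, N A ν < ∞ := by
    rw [Filter.eventually_all_finset]
    exact fun A hA => hP.ae_N_lt_top hinf (hT A hA).1 (hT A hA).2
  filter_upwards [h1, h2] with ν hν1 hν2 A hA
  refine ⟨hν2 A hA, ?_⟩
  have h3 : N A ν = ∑ σ : atomIndex μ T with A ∈ σ.1, N (atom T σ) ν := by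
    refine measure_eq_sum_atom (fun A hA => (hT A hA).1) hA fun σ h => ?_
    by_cases hσ : σ ⊆ T
    · exact hν1 σ (Finset.mem_powerset.2 hσ) h
    · have : atom T σ = ∅ := Set.eq_empty_of_forall_notMem fun x hx =>
        hσ (by rw [← hx]; exact Finset.filter_subset _ _)
      rw [this, measure_empty]
  unfold count
  rw [h3, ENNReal.toReal_sum]
  intro σ hσ
  refine ne_top_of_le_ne_top (hν2 A hA).ne (measure_mono ?_)
  exact atom_subset (mem_atomIndex.1 σ.2).1 (Finset.mem_filter.1 hσ).2

open Classical in
omit [SigmaFinite μ] in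
lemma IsFiniteMeasureFamily.measure_toReal_eq_sum (hT : IsFiniteMeasureFamily μ T) {A : Set X}
    (hA : A ∈ T) :
    (μ A).toReal = ∑ σ : atomIndex μ T with A ∈ σ.1, ((μ (atom T σ)).toNNReal : ℝ) := by
  rw [measure_eq_sum_atom (fun A hA => (hT A hA).1) hA (μ := μ) (fun _ h => h), ENNReal.toReal_sum]
  · rfl
  · exact fun σ _ => (hT.measure_atom_lt_top σ).ne

omit [SigmaFinite μ] in
lemma IsPoisson.isPoissonFamily (hP : IsPoisson μ P) (hT : IsFiniteMeasureFamily μ T) :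
    IsPoissonFamily P (fun σ : atomIndex μ T => count (atom T σ))
      (fun σ => (μ (atom T σ)).toNNReal) := by
  obtain ⟨h1, h2⟩ := hP (Fintype.card (atomIndex μ T))
    (fun i => atom T ((Fintype.equivFin (atomIndex μ T)).symm i))
    (fun i => hT.measurableSet_atom _) (fun i => (mem_atomIndex.1 (Subtype.prop _)).2.2)
    (fun i => hT.measure_atom_lt_top _)
    (fun i j hij => pairwise_disjoint_atom T fun h =>
      hij ((Fintype.equivFin (atomIndex μ T)).symm.injective (Subtype.ext h)))
  refine ⟨fun σ => measurable_count (hT.measurableSet_atom σ), ?_, fun σ => ?_⟩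
  · have h3 := h1.precomp (Fintype.equivFin (atomIndex μ T)).injective
    have h4 := h3.comp (fun _ => ENNReal.toReal) fun _ => ENNReal.measurable_toReal
    simp only [Function.comp_def, Equiv.symm_apply_apply] at h4
    exact h4
  · have h3 := h2 (Fintype.equivFin _ σ)
    rw [Equiv.symm_apply_apply] at h3
    have h4 : count (atom T σ) = ENNReal.toReal ∘ N (atom T σ) := rfl
    rw [h4, ← Measure.map_map ENNReal.measurable_toReal (measurable_N (hT.measurableSet_atom σ)), h3,
      Measure.map_map ENNReal.measurable_toReal .of_discrete]
    rfl

end Atoms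

end

/-! ### Elements of the algebraic span as chaos sums over atoms. -/

section

variable {X : Type*} [MeasurableSpace X] {μ : Measure X} {P : Measure (CountingMeasure X)}

/-- The elementary integrals of order `n`, as elements of `L²`. -/
def elementarySet (μ : Measure X) (P : Measure (CountingMeasure X)) (n : ℕ) : Set (Lp ℂ 2 P) :=
  {F : Lp ℂ 2 P | ∃ A : Fin n → Set X, (∀ i, MeasurableSet (A i)) ∧
    (∀ i, μ (A i) < ∞) ∧ Pairwise (fun i j => Disjoint (A i) (A j)) ∧
    F =ᵐ[P] elementaryIntegral μ A}

/-- The chaos sum of order `n` with coefficients `c` over the atoms of `T`. -/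
noncomputable def atomSum (μ : Measure X) (T : Finset (Set X)) (n : ℕ)
    (c : Finset (atomIndex μ T) → ℂ) (ν : CountingMeasure X) : ℂ :=
  chaosSum (fun σ : atomIndex μ T => count (atom T σ)) (fun σ => (μ (atom T σ)).toNNReal) n c ν

lemma measurable_atomSum {T : Finset (Set X)} (hT : IsFiniteMeasureFamily μ T) (n : ℕ)
    (c : Finset (atomIndex μ T) → ℂ) : Measurable (atomSum μ T n c) := by
  have := fun σ => measurable_count (hT.measurableSet_atom σ)
  unfold atomSum chaosSum centredProd
  fun_prop

section Representation

variable [SigmaFinite μ] {T : Finset (Set X)}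

lemma IsPoisson.elementaryIntegral_ae_eq_atomSum (hP : IsPoisson μ P) (hinf : μ Set.univ = ∞)
    (hT : IsFiniteMeasureFamily μ T) {n : ℕ} {A : Fin n → Set X} (hA : ∀ i, A i ∈ T)
    (hd : Pairwise fun i j => Disjoint (A i) (A j)) :
    ∃ c, elementaryIntegral μ A =ᵐ[P] atomSum μ T n c := by
  classical
  set t : Fin n → Finset (atomIndex μ T) := fun i => {σ : atomIndex μ T | A i ∈ σ.1} with ht
  -- A choice `p` of one atom from each `A i` is injective: the `A i` are disjoint, and atoms of
  -- positive measure are nonempty. So the expanded product has no repeated factors.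
  have hinj : ∀ p ∈ Fintype.piFinset t, Function.Injective p := fun p hp i j hij => by
    by_contra hne
    have hi := (Finset.mem_filter.1 (Fintype.mem_piFinset.1 hp i)).2
    have hj := (Finset.mem_filter.1 (Fintype.mem_piFinset.1 hp j)).2
    rw [← hij] at hj
    obtain ⟨h1, -, h2⟩ := mem_atomIndex.1 (p i).2
    obtain ⟨x, hx⟩ := nonempty_of_measure_ne_zero h2.ne'
    exact Set.disjoint_left.1 (hd hne) (atom_subset h1 hi hx) (atom_subset h1 hj hx)
  -- The coefficient of `α` is the number of choices of atoms with image `α`.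
  refine ⟨fun α => (({p ∈ Fintype.piFinset t | Finset.univ.image p = α} : Finset _).card : ℂ), ?_⟩
  filter_upwards [hP.ae_count_eq_sum hinf hT] with ν hν
  have h1 : ∀ i, ((N (A i) ν).toReal - (μ (A i)).toReal : ℝ) =
      ∑ σ ∈ t i, (count (atom T σ) ν - (μ (atom T σ)).toNNReal) := fun i => by
    rw [Finset.sum_sub_distrib, ← hT.measure_toReal_eq_sum (hA i), ← (hν _ (hA i)).2]
    rfl
  simp only [elementaryIntegral, h1]
  rw [← Complex.ofReal_prod, Finset.prod_univ_sum]
  set ξ : atomIndex μ T → CountingMeasure X → ℝ := fun σ => count (atom T σ)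
  set r : atomIndex μ T → ℝ≥0 := fun σ => (μ (atom T σ)).toNNReal
  have h2 : ∀ p ∈ Fintype.piFinset t, ∏ i, (ξ (p i) ν - r (p i)) =
      centredProd ξ r (Finset.univ.image p) ν := fun p hp => by
    rw [centredProd, Finset.prod_image fun i _ j _ h => hinj p hp h]
  have h3 : ∀ p ∈ Fintype.piFinset t,
      Finset.univ.image p ∈ Finset.powersetCard n (Finset.univ : Finset (atomIndex μ T)) :=
    fun p hp => by
      rw [Finset.mem_powersetCard_univ, Finset.card_image_of_injective _ (hinj p hp),
        Finset.card_univ, Fintype.card_fin]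
  rw [Finset.sum_congr rfl h2, ← Finset.sum_fiberwise_of_maps_to h3, atomSum, chaosSum,
    Complex.ofReal_sum]
  refine Finset.sum_congr rfl fun α _ => ?_
  rw [Finset.sum_congr rfl (g := fun _ => centredProd ξ r α ν) fun p hp => by
    rw [(Finset.mem_filter.1 hp).2], Finset.sum_const, nsmul_eq_mul]
  push_cast
  rfl

/-- One family `T` serves all the elementary integrals composing `F`. The set `S` is put into `T` so
that `N S` also becomes a sum of atom counts. -/
lemma IsPoisson.exists_atomSum (hP : IsPoisson μ P) (hinf : μ Set.univ = ∞) {n : ℕ}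
    {F : Lp ℂ 2 P} (hF : F ∈ Submodule.span ℂ (elementarySet μ P n)) {S : Set X}
    (hS : MeasurableSet S) (hS' : μ S < ∞) :
    ∃ T, IsFiniteMeasureFamily μ T ∧ S ∈ T ∧ ∃ c, F =ᵐ[P] atomSum μ T n c := by
  classical
  obtain ⟨G, hG, hFG⟩ := Submodule.mem_span_finite_of_mem_span hF
  have hG' : ∀ g ∈ G, ∃ A : Fin n → Set X, (∀ i, MeasurableSet (A i)) ∧
    (∀ i, μ (A i) < ∞) ∧ Pairwise (fun i j => Disjoint (A i) (A j)) ∧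
    g =ᵐ[P] elementaryIntegral μ A := fun g hg => hG hg
  choose! A hA1 hA2 hA3 hA4 using hG'
  set T : Finset (Set X) := insert S (G.biUnion fun g => Finset.univ.image (A g)) with hTdef
  have hT : IsFiniteMeasureFamily μ T := by
    intro B hB
    rcases Finset.mem_insert.1 hB with rfl | hB
    · exact ⟨hS, hS'⟩
    · obtain ⟨g, hg, hB⟩ := Finset.mem_biUnion.1 hB
      obtain ⟨i, -, rfl⟩ := Finset.mem_image.1 hB
      exact ⟨hA1 g hg i, hA2 g hg i⟩
  refine ⟨T, hT, Finset.mem_insert_self _ _, ?_⟩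
  refine Submodule.span_induction (p := fun (F : Lp ℂ 2 P) _ => ∃ c, F =ᵐ[P] atomSum μ T n c) ?_ ?_ ?_ ?_ hFG
  · intro g hg
    obtain ⟨c, hc⟩ := hP.elementaryIntegral_ae_eq_atomSum hinf hT (A := A g) (fun i =>
      Finset.mem_insert_of_mem (Finset.mem_biUnion.2
        ⟨g, hg, Finset.mem_image_of_mem _ (Finset.mem_univ i)⟩)) (hA3 g hg)
    exact ⟨c, (hA4 g hg).trans hc⟩
  · refine ⟨0, (Lp.coeFn_zero _ _ _).trans (Filter.Eventually.of_forall fun ν => ?_)⟩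
    simp [atomSum, chaosSum]
  · rintro f g - - ⟨c, hc⟩ ⟨d, hd⟩
    refine ⟨c + d, ?_⟩
    filter_upwards [Lp.coeFn_add f g, hc, hd] with ν h1 h2 h3
    rw [h1, Pi.add_apply, h2, h3]
    simp [atomSum, chaosSum, add_mul, Finset.sum_add_distrib]
  · rintro a f - ⟨c, hc⟩
    refine ⟨a • c, ?_⟩
    filter_upwards [Lp.coeFn_smul a f, hc] with ν h1 h2
    rw [h1, Pi.smul_apply, h2]
    simp [atomSum, chaosSum, Finset.mul_sum, mul_assoc]

end Representation

/-! ### Weighted second moments on the algebraic span. -/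

section Estimates

variable {T : Finset (Set X)}

lemma IsPoisson.lintegral_enorm_atomSum_sq (hP : IsPoisson μ P) (hT : IsFiniteMeasureFamily μ T)
    (n : ℕ) (c : Finset (atomIndex μ T) → ℂ) :
    ∫⁻ ν, ‖atomSum μ T n c ν‖ₑ ^ 2 ∂P = ENNReal.ofReal (∫ ν, ‖atomSum μ T n c ν‖ ^ 2 ∂P) := by
  classical
  rw [ofReal_integral_eq_lintegral_ofReal]
  · refine lintegral_congr fun ν => ?_
    rw [ENNReal.ofReal_pow (norm_nonneg _), ofReal_norm]
  · exact (hP.isPoissonFamily hT).integrable_norm_chaosSum_sq n c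
  · exact Filter.Eventually.of_forall fun ν => by positivity

lemma IsPoisson.lintegral_enorm_atomSum_sq_mul (hP : IsPoisson μ P)
    (hT : IsFiniteMeasureFamily μ T) (n : ℕ) (c : Finset (atomIndex μ T) → ℂ)
    (J : Finset (atomIndex μ T)) :
    ∫⁻ ν, ‖atomSum μ T n c ν‖ₑ ^ 2 * ENNReal.ofReal (∑ σ ∈ J, count (atom T σ) ν) ∂P =
      ENNReal.ofReal (∫ ν, ‖atomSum μ T n c ν‖ ^ 2 * ∑ σ ∈ J, count (atom T σ) ν ∂P) := by
  classical
  rw [ofReal_integral_eq_lintegral_ofReal]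
  · refine lintegral_congr fun ν => ?_
    rw [ENNReal.ofReal_mul (by positivity), ENNReal.ofReal_pow (norm_nonneg _), ofReal_norm]
  · exact ((hP.isPoissonFamily hT).integral_norm_chaosSum_sq_mul_sum n c J).1
  · exact Filter.Eventually.of_forall fun ν => mul_nonneg (by positivity)
      (Finset.sum_nonneg fun σ _ => ENNReal.toReal_nonneg)

variable [SigmaFinite μ]

lemma IsPoisson.lintegral_enorm_sq_mul_N_bounds (hP : IsPoisson μ P) (hinf : μ Set.univ = ∞)
    {n : ℕ} {F : Lp ℂ 2 P} (hF : F ∈ Submodule.span ℂ (elementarySet μ P n)) {S : Set X}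
    (hS : MeasurableSet S) (hS' : μ S < ∞) :
    μ S * ∫⁻ ν, ‖F ν‖ₑ ^ 2 ∂P ≤ ∫⁻ ν, ‖F ν‖ₑ ^ 2 * N S ν ∂P ∧
    ∫⁻ ν, ‖F ν‖ₑ ^ 2 * N S ν ∂P ≤ (μ S + n) * ∫⁻ ν, ‖F ν‖ₑ ^ 2 ∂P := by
  classical
  obtain ⟨T, hT, hST, c, hc⟩ := hP.exists_atomSum hinf hF hS hS'
  set J : Finset (atomIndex μ T) := {σ : atomIndex μ T | S ∈ σ.1}
  have hb : ∫⁻ ν, ‖F ν‖ₑ ^ 2 ∂P = ENNReal.ofReal (∫ ν, ‖atomSum μ T n c ν‖ ^ 2 ∂P) := by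
    rw [← hP.lintegral_enorm_atomSum_sq hT]
    refine lintegral_congr_ae ?_
    filter_upwards [hc] with ν hν
    rw [hν]
  have ha : ∫⁻ ν, ‖F ν‖ₑ ^ 2 * N S ν ∂P =
      ENNReal.ofReal (∫ ν, ‖atomSum μ T n c ν‖ ^ 2 * ∑ σ ∈ J, count (atom T σ) ν ∂P) := by
    rw [← hP.lintegral_enorm_atomSum_sq_mul hT]
    refine lintegral_congr_ae ?_
    filter_upwards [hc, hP.ae_count_eq_sum hinf hT] with ν hν hν'
    rw [hν, ← (hν' S hST).2, count, ENNReal.ofReal_toReal (hν' S hST).1.ne]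
  have hm : μ S = ENNReal.ofReal (∑ σ ∈ J, ((μ (atom T σ)).toNNReal : ℝ)) := by
    rw [← hT.measure_toReal_eq_sum hST, ENNReal.ofReal_toReal hS'.ne]
  have hm' : μ S + n = ENNReal.ofReal (∑ σ ∈ J, ((μ (atom T σ)).toNNReal : ℝ) + n) := by
    rw [ENNReal.ofReal_add (by positivity) (by positivity), ← hm, ENNReal.ofReal_natCast]
  rw [ha, hb, hm', hm, ← ENNReal.ofReal_mul (by positivity), ← ENNReal.ofReal_mul (by positivity)]
  exact ⟨ENNReal.ofReal_le_ofReal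
      ((hP.isPoissonFamily hT).le_integral_norm_chaosSum_sq_mul_sum n c J),
    ENNReal.ofReal_le_ofReal
      ((hP.isPoissonFamily hT).integral_norm_chaosSum_sq_mul_sum_le n c J)⟩

/-- Take for `S` the union of all atoms used by `F`: every factor then lies in `S` and the upper
bound is attained. -/
lemma IsPoisson.exists_lintegral_enorm_sq_mul_N_eq (hP : IsPoisson μ P)
    (hinf : μ Set.univ = ∞) {n : ℕ} {F : Lp ℂ 2 P}
    (hF : F ∈ Submodule.span ℂ (elementarySet μ P n)) :
    ∃ S, MeasurableSet S ∧ μ S < ∞ ∧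
      ∫⁻ ν, ‖F ν‖ₑ ^ 2 * N S ν ∂P = (μ S + n) * ∫⁻ ν, ‖F ν‖ₑ ^ 2 ∂P := by
  classical
  obtain ⟨T, hT, -, c, hc⟩ := hP.exists_atomSum hinf hF MeasurableSet.empty (by simp)
  set S : Set X := ⋃ σ ∈ (Finset.univ : Finset (atomIndex μ T)), atom T σ
  have hS : MeasurableSet S := Finset.measurableSet_biUnion _ fun σ _ => hT.measurableSet_atom σ
  have hdis : Pairwise fun σ τ : atomIndex μ T => Disjoint (atom T σ) (atom T τ) :=
    fun σ τ h => pairwise_disjoint_atom T fun h' => h (Subtype.ext h')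
  have hμS : μ S = ∑ σ : atomIndex μ T, μ (atom T σ) :=
    measure_biUnion_finset (fun _ _ _ _ h => hdis h) fun σ _ => hT.measurableSet_atom σ
  have hS' : μ S < ∞ := by
    rw [hμS]
    exact ENNReal.sum_lt_top.2 fun σ _ => hT.measure_atom_lt_top σ
  refine ⟨S, hS, hS', ?_⟩
  have hb : ∫⁻ ν, ‖F ν‖ₑ ^ 2 ∂P = ENNReal.ofReal (∫ ν, ‖atomSum μ T n c ν‖ ^ 2 ∂P) := by
    rw [← hP.lintegral_enorm_atomSum_sq hT]
    refine lintegral_congr_ae ?_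
    filter_upwards [hc] with ν hν
    rw [hν]
  have ha : ∫⁻ ν, ‖F ν‖ₑ ^ 2 * N S ν ∂P =
      ENNReal.ofReal (∫ ν, ‖atomSum μ T n c ν‖ ^ 2 * ∑ σ : atomIndex μ T, count (atom T σ) ν ∂P) := by
    rw [← hP.lintegral_enorm_atomSum_sq_mul hT]
    refine lintegral_congr_ae ?_
    filter_upwards [hc, hP.ae_N_lt_top hinf hS hS'] with ν hν hν'
    rw [N_biUnion _ hdis (fun σ => hT.measurableSet_atom σ)] at hν' ⊢
    unfold count
    rw [hν, ← ENNReal.toReal_sum (ENNReal.sum_ne_top.1 hν'.ne), ENNReal.ofReal_toReal hν'.ne]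
  have hm : μ S + n = ENNReal.ofReal (∑ σ : atomIndex μ T, ((μ (atom T σ)).toNNReal : ℝ) + n) := by
    rw [ENNReal.ofReal_add (by positivity) (by positivity), ENNReal.ofReal_natCast, hμS,
      ENNReal.ofReal_sum_of_nonneg fun σ _ => by positivity]
    congr 1
    refine Finset.sum_congr rfl fun σ _ => ?_
    rw [ENNReal.ofReal_coe_nnreal, ENNReal.coe_toNNReal (hT.measure_atom_lt_top σ).ne]
  rw [ha, hb, hm, ← ENNReal.ofReal_mul (by positivity)]
  exact congrArg ENNReal.ofReal
    ((hP.isPoissonFamily hT).integral_norm_chaosSum_sq_mul_sum_univ n c)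

end Estimates

end

section

variable {X : Type*} [MeasurableSpace X] {μ : Measure X} {P : Measure (CountingMeasure X)}

/-! ### Weighted second moments on the closed chaos. -/

section Weighted

variable {S : Set X}

lemma lintegral_enorm_sq_eq (F : Lp ℂ 2 P) : ∫⁻ ν, ‖F ν‖ₑ ^ 2 ∂P = ‖F‖ₑ ^ 2 := by
  have h := eLpNorm_nnreal_pow_eq_lintegral (f := F) (μ := P) (p := 2) (by norm_num)
  rw [Lp.enorm_def]
  simpa using h.symm

lemma eLpNorm_withDensity_sq (hS : MeasurableSet S) (F : Lp ℂ 2 P) :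
    eLpNorm F 2 (P.withDensity (N S)) ^ 2 = ∫⁻ ν, ‖F ν‖ₑ ^ 2 * N S ν ∂P := by
  have h := eLpNorm_nnreal_pow_eq_lintegral (f := F) (μ := P.withDensity (N S)) (p := 2)
    (by norm_num)
  have h2 : AEMeasurable (fun ν => ‖F ν‖ₑ ^ 2) P :=
    (Lp.stronglyMeasurable F).measurable.enorm.pow_const 2 |>.aemeasurable
  rw [lintegral_withDensity_eq_lintegral_mul₀ (measurable_N hS).aemeasurable (by
    simpa using h2)] at h
  simp only [Pi.mul_apply, NNReal.coe_ofNat, ENNReal.coe_ofNat, ENNReal.rpow_ofNat] at h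
  rw [h]
  exact lintegral_congr fun ν => mul_comm _ _

lemma eLpNorm_withDensity_congr {F G : CountingMeasure X → ℂ} (h : F =ᵐ[P] G) :
    eLpNorm F 2 (P.withDensity (N S)) = eLpNorm G 2 (P.withDensity (N S)) :=
  eLpNorm_congr_ae ((withDensity_absolutelyContinuous P (N S)).ae_le h)

lemma enorm_add_sq_add_enorm_sub_sq (a b : ℂ) :
    ‖a + b‖ₑ ^ 2 + ‖a - b‖ₑ ^ 2 = 2 * ‖a‖ₑ ^ 2 + 2 * ‖b‖ₑ ^ 2 := by
  have h := parallelogram_law_with_norm ℝ a b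
  simp only [← ofReal_norm, ← ENNReal.ofReal_pow (norm_nonneg _)]
  rw [← ENNReal.ofReal_add (by positivity) (by positivity),
    show (2 : ℝ≥0∞) = ENNReal.ofReal 2 by simp, ← ENNReal.ofReal_mul (by positivity),
    ← ENNReal.ofReal_mul (by positivity), ← ENNReal.ofReal_add (by positivity) (by positivity)]
  congr 1
  linarith

/-- The second moment of `F` weighted by the number of points in `S`. -/
noncomputable def weightedSq (S : Set X) (F : Lp ℂ 2 P) : ℝ≥0∞ := ∫⁻ ν, ‖F ν‖ₑ ^ 2 * N S ν ∂P

lemma weightedSq_add_sub (hS : MeasurableSet S) (F G : Lp ℂ 2 P) :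
    weightedSq S (F + G) + weightedSq S (F - G) = 2 * weightedSq S F + 2 * weightedSq S G := by
  have hm : ∀ H : Lp ℂ 2 P, Measurable fun ν => ‖H ν‖ₑ ^ 2 * N S ν := fun H =>
    ((Lp.stronglyMeasurable H).measurable.enorm.pow_const 2).mul (measurable_N hS)
  unfold weightedSq
  rw [← lintegral_const_mul _ (hm F), ← lintegral_const_mul _ (hm G), ← lintegral_add_left (hm _),
    ← lintegral_add_left ((hm F).const_mul _)]
  refine lintegral_congr_ae ?_
  filter_upwards [Lp.coeFn_add F G, Lp.coeFn_sub F G] with ν h1 h2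
  rw [h1, h2, Pi.add_apply, Pi.sub_apply, ← add_mul, ← mul_assoc, ← mul_assoc, ← add_mul]
  congr 1
  exact enorm_add_sq_add_enorm_sub_sq _ _

variable [SigmaFinite μ]

/-- The bound passes from the span to its closure by Fatou's lemma along an almost everywhere
convergent subsequence. -/
lemma IsPoisson.weightedSq_le (hP : IsPoisson μ P) (hinf : μ Set.univ = ∞) {n : ℕ}
    {F : Lp ℂ 2 P} (hF : F ∈ chaos μ P n) (hS : MeasurableSet S) (hS' : μ S < ∞) :
    weightedSq S F ≤ (μ S + n) * ‖F‖ₑ ^ 2 := by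
  obtain ⟨G, hG, hGF⟩ := mem_closure_iff_seq_limit.1 hF
  obtain ⟨k, hk, hae⟩ := (tendstoInMeasure_of_tendsto_Lp hGF).exists_seq_tendsto_ae
  have h1 : weightedSq S F ≤
      Filter.liminf (fun i => ∫⁻ ν, ‖G (k i) ν‖ₑ ^ 2 * N S ν ∂P) Filter.atTop := by
    refine le_trans (lintegral_mono_ae ?_) (lintegral_liminf_le fun i =>
      ((Lp.stronglyMeasurable (G (k i))).measurable.enorm.pow_const 2).mul (measurable_N hS))
    filter_upwards [hae, hP.ae_N_lt_top hinf hS hS'] with ν hν hν'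
    have h2 : Filter.Tendsto (fun i => ‖G (k i) ν‖ₑ ^ 2 * N S ν) Filter.atTop
        (nhds (‖F ν‖ₑ ^ 2 * N S ν)) :=
      ENNReal.Tendsto.mul_const (ENNReal.Tendsto.pow hν.enorm) (Or.inr hν'.ne)
    exact h2.liminf_eq.ge
  have h3 : Filter.Tendsto (fun i => (μ S + n) * ‖G (k i)‖ₑ ^ 2) Filter.atTop
      (nhds ((μ S + n) * ‖F‖ₑ ^ 2)) :=
    ENNReal.Tendsto.const_mul (ENNReal.Tendsto.pow ((hGF.comp hk.tendsto_atTop).enorm))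
      (Or.inr (by finiteness))
  refine h1.trans ?_
  rw [← h3.liminf_eq]
  refine Filter.liminf_le_liminf (Filter.Eventually.of_forall fun i => ?_)
  have h4 := (hP.lintegral_enorm_sq_mul_N_bounds hinf (hG (k i)) hS hS').2
  rwa [lintegral_enorm_sq_eq] at h4

/-- Fatou goes the wrong way for a lower bound. Instead the upper bound, applied to `G i - F`, shows
convergence in the weighted `L²` seminorm `s`, and the triangle inequality finishes. -/
lemma IsPoisson.le_weightedSq (hP : IsPoisson μ P) (hinf : μ Set.univ = ∞) {n : ℕ}
    {F : Lp ℂ 2 P} (hF : F ∈ chaos μ P n) (hS : MeasurableSet S) (hS' : μ S < ∞) :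
    μ S * ‖F‖ₑ ^ 2 ≤ weightedSq S F := by
  obtain ⟨G, hG, hGF⟩ := mem_closure_iff_seq_limit.1 hF
  set s : Lp ℂ 2 P → ℝ≥0∞ := fun H => eLpNorm H 2 (P.withDensity (N S)) with hs
  have hsq : ∀ H, s H ^ 2 = weightedSq S H := fun H => eLpNorm_withDensity_sq hS H
  have h1 : Filter.Tendsto (fun i => s (G i - F) ^ 2) Filter.atTop (nhds 0) := by
    have h2 : Filter.Tendsto (fun i => (μ S + n) * ‖G i - F‖ₑ ^ 2) Filter.atTop (nhds 0) := by
      have h3 : Filter.Tendsto (fun i => G i - F) Filter.atTop (nhds 0) := by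
        simpa using hGF.sub_const F
      have h4 := ENNReal.Tendsto.const_mul (ENNReal.Tendsto.pow (n := 2) h3.enorm)
        (a := μ S + n) (Or.inr (by finiteness))
      simpa using h4
    refine tendsto_of_tendsto_of_tendsto_of_le_of_le tendsto_const_nhds h2 (fun _ => zero_le)
      fun i => ?_
    have hm : G i - F ∈ chaos μ P n :=
      Submodule.sub_mem _ (Submodule.le_topologicalClosure _ (hG i)) hF
    exact (hsq _).trans_le (hP.weightedSq_le hinf hm hS hS')
  have h5 : Filter.Tendsto (fun i => s (G i - F)) Filter.atTop (nhds 0) := by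
    have h6 : Filter.Tendsto (fun i => s (G i - F)) Filter.atTop (nhds (0 ^ (1 / 2 : ℝ))) :=
      (h1.ennrpow_const (1 / 2)).congr fun i => by
        rw [← ENNReal.rpow_two, ← ENNReal.rpow_mul]
        norm_num
    simpa using h6
  have h7 : ∀ i, s (G i) ≤ s F + s (G i - F) := fun i => by
    have hms : ∀ H : Lp ℂ 2 P, AEStronglyMeasurable H (P.withDensity (N S)) := fun H =>
      (Lp.stronglyMeasurable H).aestronglyMeasurable
    have h8 := eLpNorm_add_le (hms F) (hms (G i - F)) (p := 2) (by norm_num)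
    refine le_trans (le_of_eq (eLpNorm_withDensity_congr ?_)) h8
    filter_upwards [Lp.coeFn_sub (G i) F] with ν hν
    rw [Pi.add_apply, hν, Pi.sub_apply, add_sub_cancel]
  have h9 : Filter.Tendsto (fun i => (s F + s (G i - F)) ^ 2) Filter.atTop
      (nhds ((s F + 0) ^ 2)) := ENNReal.Tendsto.pow (tendsto_const_nhds.add h5)
  rw [add_zero, hsq] at h9
  have h10 : Filter.Tendsto (fun i => μ S * ‖G i‖ₑ ^ 2) Filter.atTop (nhds (μ S * ‖F‖ₑ ^ 2)) :=
    ENNReal.Tendsto.const_mul (ENNReal.Tendsto.pow hGF.enorm) (Or.inr hS'.ne)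
  refine le_of_tendsto_of_tendsto' h10 h9 fun i => ?_
  have h11 := (hP.lintegral_enorm_sq_mul_N_bounds hinf (hG i) hS hS').1
  rw [lintegral_enorm_sq_eq] at h11
  refine h11.trans ?_
  rw [← eLpNorm_withDensity_sq hS]
  exact pow_le_pow_left' (h7 i) 2

/-- An element of a chaos of positive order, the squared modulus of which is uncorrelated with
the number of points in each set of finite measure, vanishes. -/
lemma IsPoisson.eq_zero_of_weightedSq_eq (hP : IsPoisson μ P) (hinf : μ Set.univ = ∞) {n : ℕ}
    (hn : 1 ≤ n) {F : Lp ℂ 2 P} (hF : F ∈ chaos μ P n)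
    (h : ∀ S, MeasurableSet S → μ S < ∞ → weightedSq S F = μ S * ‖F‖ₑ ^ 2) : F = 0 := by
  -- Let `Q = weightedSq S - μ(S) ‖·‖²` with `S` adapted to `G`. Then `0 ≤ Q ≤ n ‖·‖²`, `Q(F) = 0`
  -- and `Q(G) = n ‖G‖²`, so the parallelogram law for `F` and `F - G` gives `n ‖G‖² ≤ 2 Q(F - G) ≤
  -- 2n ‖F - G‖²`. The computation keeps the two parts of `Q` apart to avoid subtraction in `ℝ≥0∞`.
  have key : ∀ G ∈ Submodule.span ℂ (elementarySet μ P n), ‖G‖ ^ 2 ≤ 2 * ‖F - G‖ ^ 2 := by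
    intro G hG
    obtain ⟨S, hS, hS', hGS⟩ := hP.exists_lintegral_enorm_sq_mul_N_eq hinf hG
    rw [lintegral_enorm_sq_eq] at hGS
    have hGc : G ∈ chaos μ P n := Submodule.le_topologicalClosure _ hG
    have h1 := weightedSq_add_sub hS F (F - G)
    rw [sub_sub_cancel, h S hS hS'] at h1
    have h2 := hP.le_weightedSq hinf (Submodule.add_mem _ hF (Submodule.sub_mem _ hF hGc)) hS hS'
    have h3 := hP.weightedSq_le hinf (Submodule.sub_mem _ hF hGc) hS hS'
    have h4 : μ S * ‖F + (F - G)‖ₑ ^ 2 + (μ S + n) * ‖G‖ₑ ^ 2 ≤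
        2 * (μ S * ‖F‖ₑ ^ 2) + 2 * ((μ S + n) * ‖F - G‖ₑ ^ 2) := by
      calc μ S * ‖F + (F - G)‖ₑ ^ 2 + (μ S + n) * ‖G‖ₑ ^ 2
          ≤ weightedSq S (F + (F - G)) + weightedSq S G := add_le_add h2 hGS.ge
        _ = _ := h1
        _ ≤ _ := by gcongr
    obtain ⟨m, hm⟩ : ∃ m : ℝ≥0, (m : ℝ≥0∞) = μ S := ⟨_, ENNReal.coe_toNNReal hS'.ne⟩
    rw [← hm] at h4
    simp only [enorm_eq_nnnorm] at h4
    norm_cast at h4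
    have h5 := parallelogram_law_with_norm ℂ F (F - G)
    rw [sub_sub_cancel] at h5
    have h6 : (m : ℝ) * ‖F + (F - G)‖ ^ 2 + (m + n) * ‖G‖ ^ 2 ≤
        2 * (m * ‖F‖ ^ 2) + 2 * ((m + n) * ‖F - G‖ ^ 2) := by exact_mod_cast h4
    have hn' : (1 : ℝ) ≤ n := by exact_mod_cast hn
    have h7 : (n : ℝ) * ‖G‖ ^ 2 ≤ n * (2 * ‖F - G‖ ^ 2) := by
      linear_combination h6 - (m : ℝ) * h5
    exact le_of_mul_le_mul_left h7 (by linarith)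
  obtain ⟨G, hG, hGF⟩ := mem_closure_iff_seq_limit.1 hF
  have h1 : Filter.Tendsto (fun i => ‖G i‖ ^ 2) Filter.atTop (nhds (‖F‖ ^ 2)) := hGF.norm.pow 2
  have h2 : Filter.Tendsto (fun i => 2 * ‖F - G i‖ ^ 2) Filter.atTop (nhds (2 * ‖F - F‖ ^ 2)) :=
    ((tendsto_const_nhds.sub hGF).norm.pow 2).const_mul 2
  have h3 := le_of_tendsto_of_tendsto' h1 h2 fun i => key _ (hG i)
  simp only [sub_self, norm_zero, ne_eq, OfNat.ofNat_ne_zero, not_false_eq_true, zero_pow,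
    mul_zero] at h3
  exact norm_eq_zero.1 (pow_eq_zero_iff two_ne_zero |>.1 (le_antisymm h3 (by positivity)))

lemma IsPoisson.setLIntegral_N_eq_of_integral_eq_zero [IsFiniteMeasure P] (hP : IsPoisson μ P)
    (hinf : μ Set.univ = ∞) (hS : MeasurableSet S) (hS' : μ S < ∞) {D : Set (CountingMeasure X)}
    (h1 : ∫ ν in D, elementaryIntegral μ (fun _ : Fin 1 => S) ν ∂P = 0) :
    ∫⁻ ν in D, N S ν ∂P = μ S * P D := by
  simp only [elementaryIntegral, Finset.univ_unique,
    Finset.prod_singleton] at h1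
  rw [integral_complex_ofReal, Complex.ofReal_eq_zero] at h1
  have hi : Integrable (fun ν => (N S ν).toReal) P := (hP.integrable_count hinf hS hS').1
  rw [integral_sub hi.integrableOn (integrable_const _), sub_eq_zero] at h1
  have h2 : ∫⁻ ν in D, N S ν ∂P = ENNReal.ofReal (∫ ν in D, (N S ν).toReal ∂P) := by
    rw [ofReal_integral_eq_lintegral_ofReal hi.integrableOn
      (Filter.Eventually.of_forall fun _ => ENNReal.toReal_nonneg)]
    refine lintegral_congr_ae (ae_restrict_of_ae ?_)
    filter_upwards [hP.ae_N_lt_top hinf hS hS'] with ν hν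
    exact (ENNReal.ofReal_toReal hν.ne).symm
  rw [h2, h1, setIntegral_const, smul_eq_mul, mul_comm, ENNReal.ofReal_mul ENNReal.toReal_nonneg,
    ENNReal.ofReal_toReal hS'.ne, ofReal_measureReal]

end Weighted

/-! ### The conditional expectation kills every chaos of positive order. -/

section ConditionalExpectation

variable {C : MeasurableSpace (CountingMeasure X)} {hC : C ≤ CountingMeasure.sigmaAlgebra}

lemma setIntegral_condExpOp [IsFiniteMeasure P] (F : Lp ℂ 2 P) {D : Set (CountingMeasure X)}
    (hD : MeasurableSet[C] D) : ∫ ν in D, condExpOp C P hC F ν ∂P = ∫ ν in D, F ν ∂P :=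
  integral_condExpL2_eq hC F hD (measure_ne_top P D)

lemma exists_stronglyMeasurable_condExpOp (F : Lp ℂ 2 P) :
    ∃ g : CountingMeasure X → ℂ, StronglyMeasurable[C] g ∧ condExpOp C P hC F =ᵐ[P] g :=
  lpMeas.aestronglyMeasurable (condExpL2 ℂ ℂ hC F)

variable [SigmaFinite μ]

lemma IsPoisson.memLp_elementaryIntegral (hP : IsPoisson μ P) (hinf : μ Set.univ = ∞) {n : ℕ}
    {A : Fin n → Set X} (hA : ∀ i, MeasurableSet (A i)) (hA' : ∀ i, μ (A i) < ∞)
    (hd : Pairwise fun i j => Disjoint (A i) (A j)) : MemLp (elementaryIntegral μ A) 2 P := by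
  classical
  have hT : IsFiniteMeasureFamily μ (Finset.univ.image A) := fun B hB => by
    obtain ⟨i, -, rfl⟩ := Finset.mem_image.1 hB
    exact ⟨hA i, hA' i⟩
  obtain ⟨c, hc⟩ := hP.elementaryIntegral_ae_eq_atomSum hinf hT
    (fun i => Finset.mem_image_of_mem A (Finset.mem_univ i)) hd
  refine MemLp.ae_eq hc.symm ?_
  rw [memLp_two_iff_integrable_sq_norm (measurable_atomSum hT n c).aestronglyMeasurable]
  exact (hP.isPoissonFamily hT).integrable_norm_chaosSum_sq n c

lemma IsPoisson.toLp_elementaryIntegral_mem_chaos (hP : IsPoisson μ P) (hinf : μ Set.univ = ∞)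
    {n : ℕ} {A : Fin n → Set X} (hA : ∀ i, MeasurableSet (A i)) (hA' : ∀ i, μ (A i) < ∞)
    (hd : Pairwise fun i j => Disjoint (A i) (A j)) :
    (hP.memLp_elementaryIntegral hinf hA hA' hd).toLp ∈ chaos μ P n :=
  Submodule.le_topologicalClosure _ (Submodule.subset_span ⟨A, hA, hA', hd, MemLp.coeFn_toLp _⟩)

variable [IsProbabilityMeasure P]

/-- `N S - μ S` belongs to the first chaos, so its conditional expectation vanishes and so does its
integral over `D`. -/
lemma IsPoisson.setLIntegral_N_eq (hP : IsPoisson μ P) (hinf : μ Set.univ = ∞)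
    (hzero : ∀ F ∈ chaos μ P 1, condExpOp C P hC F = 0) {S : Set X} (hS : MeasurableSet S)
    (hS' : μ S < ∞) {D : Set (CountingMeasure X)} (hD : MeasurableSet[C] D) :
    ∫⁻ ν in D, N S ν ∂P = μ S * P D := by
  have hd : Pairwise fun i j : Fin 1 => Disjoint ((fun _ => S) i : Set X) ((fun _ => S) j) :=
    fun i j hij => absurd (Subsingleton.elim i j) hij
  have hmem := hP.toLp_elementaryIntegral_mem_chaos hinf (fun _ : Fin 1 => hS) (fun _ => hS') hd
  have h1 := setIntegral_condExpOp (hC := hC)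
    (hP.memLp_elementaryIntegral hinf (fun _ : Fin 1 => hS) (fun _ => hS') hd).toLp hD
  rw [hzero _ hmem, integral_congr_ae (ae_restrict_of_ae (Lp.coeFn_zero ℂ 2 P)),
    integral_congr_ae (ae_restrict_of_ae (MemLp.coeFn_toLp _))] at h1
  simp only [Pi.zero_apply, integral_zero] at h1
  exact hP.setLIntegral_N_eq_of_integral_eq_zero hinf hS hS' h1.symm

/-- On `C` the measure with density `N S` is `μ S` times `P`, and `condExpOp C P hC F` has a
`C`-measurable representative. -/
lemma IsPoisson.weightedSq_condExpOp (hP : IsPoisson μ P) (hinf : μ Set.univ = ∞)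
    (hzero : ∀ F ∈ chaos μ P 1, condExpOp C P hC F = 0) {S : Set X} (hS : MeasurableSet S)
    (hS' : μ S < ∞) (F : Lp ℂ 2 P) :
    weightedSq S (condExpOp C P hC F) = μ S * ‖condExpOp C P hC F‖ₑ ^ 2 := by
  obtain ⟨g, hg, hFg⟩ := exists_stronglyMeasurable_condExpOp (hC := hC) F
  have htrim : (P.withDensity (N S)).trim hC = μ S • P.trim hC := by
    refine @Measure.ext _ C _ _ fun D hD => ?_
    rw [trim_measurableSet_eq hC hD, withDensity_apply _ (hC D hD), Measure.smul_apply,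
      trim_measurableSet_eq hC hD, smul_eq_mul, hP.setLIntegral_N_eq hinf hzero hS hS' hD]
  have hgm : Measurable[C] fun ν => ‖g ν‖ₑ ^ 2 := hg.measurable.enorm.pow_const 2
  have h1 : weightedSq S (condExpOp C P hC F) = ∫⁻ ν, ‖g ν‖ₑ ^ 2 ∂P.withDensity (N S) := by
    rw [lintegral_withDensity_eq_lintegral_mul _ (measurable_N hS) (hgm.mono hC le_rfl)]
    refine lintegral_congr_ae ?_
    filter_upwards [hFg] with ν hν
    rw [hν, Pi.mul_apply, mul_comm]
  have h2 : ‖condExpOp C P hC F‖ₑ ^ 2 = ∫⁻ ν, ‖g ν‖ₑ ^ 2 ∂P := by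
    rw [← lintegral_enorm_sq_eq]
    refine lintegral_congr_ae ?_
    filter_upwards [hFg] with ν hν
    rw [hν]
  rw [h1, h2, ← lintegral_trim hC hgm, htrim, lintegral_smul_measure, lintegral_trim hC hgm,
    smul_eq_mul]

lemma IsPoisson.condExpOp_eq_zero (hP : IsPoisson μ P) (hinf : μ Set.univ = ∞)
    (hpres : ∀ n : ℕ, 1 ≤ n → ∀ F ∈ chaos μ P n, condExpOp C P hC F ∈ chaos μ P n)
    (hzero : ∀ F ∈ chaos μ P 1, condExpOp C P hC F = 0) {n : ℕ} (hn : 1 ≤ n)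
    {F : Lp ℂ 2 P} (hF : F ∈ chaos μ P n) : condExpOp C P hC F = 0 :=
  hP.eq_zero_of_weightedSq_eq hinf hn (hpres n hn F hF) fun _ hS hS' =>
    hP.weightedSq_condExpOp hinf hzero hS hS' F

end ConditionalExpectation

end

section

variable {X : Type*} [MeasurableSpace X] {μ : Measure X}

/-! ### Cutting sets into small pieces under a nonatomic measure. -/

section Nonatomic

/-- Split repeatedly and keep the part of smaller measure, which at least halves the measure each
time. -/
lemma IsContinuous.exists_subset_measure_pos_le (hμ : IsContinuous μ) {A : Set X}
    (hA : MeasurableSet A) (h0 : 0 < μ A) (h1 : μ A < ∞) {δ : ℝ≥0∞} (hδ : 0 < δ) :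
    ∃ B ⊆ A, MeasurableSet B ∧ 0 < μ B ∧ μ B ≤ δ := by
  have h : ∀ n : ℕ, ∃ B ⊆ A, MeasurableSet B ∧ 0 < μ B ∧ 2 ^ n * μ B ≤ μ A := by
    intro n
    induction n with
    | zero => exact ⟨A, subset_rfl, hA, h0, by simp⟩
    | succ n ih =>
      obtain ⟨B, hBA, hB, hB0, hB1⟩ := ih
      obtain ⟨D, hDB, hD, hD0, hD1⟩ := hμ B hB hB0
      have hsum : μ D + μ (B \ D) = μ B := by
        rw [add_comm, ← measure_sdiff_add_inter B hD, Set.inter_eq_self_of_subset_right hDB]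
      rcases le_total (μ D) (μ (B \ D)) with hle | hle
      · refine ⟨D, hDB.trans hBA, hD, hD0, le_trans ?_ hB1⟩
        rw [pow_succ, mul_assoc, two_mul, ← hsum]
        gcongr
      · refine ⟨B \ D, Set.sdiff_subset.trans hBA, hB.diff hD, hD1, le_trans ?_ hB1⟩
        rw [pow_succ, mul_assoc, two_mul, ← hsum]
        gcongr
  obtain ⟨n, hn⟩ : ∃ n : ℕ, μ A / δ < n := ENNReal.exists_nat_gt (ENNReal.div_lt_top h1.ne hδ.ne').ne
  obtain ⟨B, hBA, hB, hB0, hB1⟩ := h n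
  refine ⟨B, hBA, hB, hB0, ?_⟩
  by_contra! hlt
  have h2 : μ A < n * δ := (ENNReal.div_lt_iff (Or.inl hδ.ne') (Or.inr h1.ne)).1 hn
  have h3 : (n : ℝ≥0∞) ≤ 2 ^ n := by exact_mod_cast n.lt_two_pow_self.le
  refine absurd (h2.trans_le ?_) (lt_irrefl (μ A))
  refine le_trans ?_ hB1
  gcongr

/-- A set of finite continuous measure is a finite union of sets of measure at most `δ`. -/
lemma IsContinuous.exists_finset_cover (hμ : IsContinuous μ) {A : Set X}
    (hA : MeasurableSet A) (h1 : μ A < ∞) {δ : ℝ≥0∞} (hδ : 0 < δ) :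
    ∃ 𝒟 : Finset (Set X), (∀ D ∈ 𝒟, MeasurableSet D ∧ D ⊆ A ∧ μ D ≤ δ) ∧ A ⊆ ⋃ D ∈ 𝒟, D := by
  classical
  set good : Set (Set X) := {E | E ⊆ A ∧ MeasurableSet E ∧ ∃ 𝒟 : Finset (Set X),
    (∀ D ∈ 𝒟, MeasurableSet D ∧ D ⊆ A ∧ μ D ≤ δ) ∧ E ⊆ ⋃ D ∈ 𝒟, D} with hgood
  suffices h : ∃ E ∈ good, μ (A \ E) ≤ δ by
    obtain ⟨E, ⟨hEA, hE, 𝒟, h𝒟, hE𝒟⟩, hEδ⟩ := h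
    refine ⟨insert (A \ E) 𝒟, fun D hD => ?_, fun x hx => ?_⟩
    · rcases Finset.mem_insert.1 hD with rfl | hD
      · exact ⟨hA.diff hE, Set.sdiff_subset, hEδ⟩
      · exact h𝒟 D hD
    · rw [Finset.set_biUnion_insert]
      by_cases hxE : x ∈ E
      · exact Or.inr (hE𝒟 hxE)
      · exact Or.inl ⟨hx, hxE⟩
  have hempty : ∅ ∈ good := ⟨Set.empty_subset _, MeasurableSet.empty, ∅, by simp, by simp⟩
  have hunion : ∀ E ∈ good, ∀ E' ∈ good, E ∪ E' ∈ good := by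
    rintro E ⟨h1, h2, 𝒟, h3, h4⟩ E' ⟨h1', h2', 𝒟', h3', h4'⟩
    refine ⟨Set.union_subset h1 h1', h2.union h2', 𝒟 ∪ 𝒟', fun D hD => ?_, ?_⟩
    · exact (Finset.mem_union.1 hD).elim (h3 D) (h3' D)
    · rw [Finset.set_biUnion_union]
      exact Set.union_subset_union h4 h4'
  -- Exhaustion: take sets covered by finitely many small pieces whose remainders in `A` have
  -- measure tending to the infimum `t`.
  obtain ⟨u, -, hu, hum⟩ := exists_seq_tendsto_sInf (S := (fun E => μ (A \ E)) '' good)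
    ⟨_, ∅, hempty, rfl⟩ (OrderBot.bddBelow _)
  set t := sInf ((fun E => μ (A \ E)) '' good)
  choose E hE hEu using hum
  have ht : ∀ E ∈ good, t ≤ μ (A \ E) := fun E hE => sInf_le ⟨E, hE, rfl⟩
  have hUm : MeasurableSet (A \ ⋃ k, E k) := hA.diff (MeasurableSet.iUnion fun k => (hE k).2.1)
  by_cases h0 : μ (A \ ⋃ k, E k) = 0
  -- If the union of the `E k` fills `A` up to a null set, continuity from above makes some finite
  -- partial union leave at most `δ`.
  · have hacc : ∀ k, Set.accumulate E k ∈ good := fun k => by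
      induction k with
      | zero => simpa [Set.accumulate_zero_nat] using hE 0
      | succ k ih =>
        rw [Set.accumulate_succ]
        exact hunion _ ih _ (hE _)
    have hanti : Antitone fun k => A \ Set.accumulate E k := fun i j hij =>
      Set.sdiff_subset_sdiff_right (Set.monotone_accumulate hij)
    have hlim := tendsto_measure_iInter_atTop (μ := μ)
      (fun k => (hA.diff (hacc k).2.1).nullMeasurableSet) hanti
      ⟨0, ((measure_mono Set.sdiff_subset).trans_lt h1).ne⟩
    rw [← Set.sdiff_iUnion, Set.iUnion_accumulate, h0] at hlim
    obtain ⟨k, hk⟩ := (hlim.eventually (gt_mem_nhds hδ)).exists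
    exact ⟨_, hacc k, hk.le⟩
  · exfalso
    -- Otherwise a small piece `B` of what is left can be added to each `E k`, which forces `t + μ B
    -- ≤ t` although `t` is finite.
    obtain ⟨B, hBsub, hB, hB0, hB1⟩ := hμ.exists_subset_measure_pos_le hUm (pos_iff_ne_zero.2 h0)
      ((measure_mono Set.sdiff_subset).trans_lt h1) hδ
    have hBA : B ⊆ A := hBsub.trans Set.sdiff_subset
    have hBgood : B ∈ good := ⟨hBA, hB, {B}, by simpa using ⟨hB, hBA, hB1⟩, by simp⟩
    have h2 : ∀ k, t + μ B ≤ u k := fun k => by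
      have h3 := ht _ (hunion _ (hE k) _ hBgood)
      have h4 : B ⊆ A \ E k := fun x hx => ⟨hBA hx, fun h => (hBsub hx).2 (Set.mem_iUnion.2 ⟨k, h⟩)⟩
      rw [← hEu k]
      have h5 : μ (A \ E k) = μ ((A \ E k) \ B) + μ B := by
        rw [← measure_sdiff_add_inter (A \ E k) hB, Set.inter_eq_self_of_subset_right h4]
      have h6 : A \ (E k ∪ B) = (A \ E k) \ B := Set.sdiff_sdiff.symm
      simp only
      rw [h5, ← h6]
      gcongr
    have h7 := ge_of_tendsto' hu h2
    have h8 : t < ∞ := (ht ∅ hempty).trans_lt (by simpa using h1)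
    exact absurd h7 (not_le.2 (ENNReal.lt_add_right h8.ne hB0.ne'))

end Nonatomic

end

section

variable {X : Type*} [MeasurableSpace X] {μ : Measure X} {P : Measure (CountingMeasure X)}

/-- The event `S` is uncorrelated with all the elementary integrals. -/
def IsUncorrelated (μ : Measure X) (P : Measure (CountingMeasure X))
    (S : Set (CountingMeasure X)) : Prop :=
  ∀ (n : ℕ) (A : Fin n → Set X), (∀ i, MeasurableSet (A i)) → (∀ i, μ (A i) < ∞) →
    Pairwise (fun i j => Disjoint (A i) (A j)) →
    ∫ ν in S, elementaryIntegral μ A ν ∂P = P.real S * ∫ ν, elementaryIntegral μ A ν ∂P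

/-! ### Uncorrelatedness passes to products of affine approximations. -/

section Exponentials

variable {T : Finset (Set X)}

lemma centredProd_eq_elementaryIntegral (α : Finset (atomIndex μ T)) (ν : CountingMeasure X) :
    ((centredProd (fun σ : atomIndex μ T => count (atom T σ))
      (fun σ => (μ (atom T σ)).toNNReal) α ν : ℝ) : ℂ) =
    elementaryIntegral μ (fun i : Fin α.card => atom T (α.equivFin.symm i).1) ν := by
  rw [centredProd, elementaryIntegral, ← Complex.ofReal_prod, ← Finset.prod_coe_sort,
    ← α.equivFin.symm.prod_comp]
  rfl

lemma pairwise_disjoint_atom_equivFin (α : Finset (atomIndex μ T)) :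
    Pairwise fun i j : Fin α.card =>
      Disjoint (atom T (α.equivFin.symm i).1) (atom T (α.equivFin.symm j).1) := fun _ _ hij =>
  pairwise_disjoint_atom T fun h =>
    hij (α.equivFin.symm.injective (Subtype.ext (Subtype.ext h)))

/-- The approximation of an exponential by an element of the sum of the chaoses. -/
noncomputable def affineProd (μ : Measure X) (T : Finset (Set X)) (θ : atomIndex μ T → ℝ)
    (ν : CountingMeasure X) : ℂ :=
  ∏ σ : atomIndex μ T, affineExp (μ (atom T σ)).toNNReal (θ σ) (count (atom T σ) ν)

/-- Expanding a product of factors `1 + t_σ (ξ_σ - r_σ)` yields one elementary integral for each set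
of atoms, so an uncorrelated event is uncorrelated with `affineProd`. -/
lemma affineProd_eq_sum (θ : atomIndex μ T → ℝ) (ν : CountingMeasure X) :
    affineProd μ T θ ν = ∑ α : Finset (atomIndex μ T),
      ((∏ σ : atomIndex μ T,
          Complex.exp ((μ (atom T σ)).toNNReal * (Complex.exp (θ σ * Complex.I) - 1))) *
        ∏ σ ∈ α, (Complex.exp (θ σ * Complex.I) - 1)) *
      elementaryIntegral μ (fun i : Fin α.card => atom T (α.equivFin.symm i).1) ν := by
  classical
  unfold affineProd affineExp
  rw [Finset.prod_mul_distrib, Finset.prod_one_add, Finset.powerset_univ, Finset.mul_sum]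
  refine Finset.sum_congr rfl fun α _ => ?_
  rw [← centredProd_eq_elementaryIntegral, Finset.prod_mul_distrib, mul_assoc, centredProd,
    Complex.ofReal_prod]

variable [SigmaFinite μ] [IsProbabilityMeasure P]

lemma IsPoisson.integrable_elementaryIntegral (hP : IsPoisson μ P) (hinf : μ Set.univ = ∞) {n : ℕ}
    {A : Fin n → Set X} (hA : ∀ i, MeasurableSet (A i)) (hA' : ∀ i, μ (A i) < ∞)
    (hd : Pairwise fun i j => Disjoint (A i) (A j)) : Integrable (elementaryIntegral μ A) P :=
  (hP.memLp_elementaryIntegral hinf hA hA' hd).integrable (by norm_num)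

lemma IsPoisson.integrable_affineProd (hP : IsPoisson μ P) (hinf : μ Set.univ = ∞)
    (hT : IsFiniteMeasureFamily μ T) (θ : atomIndex μ T → ℝ) : Integrable (affineProd μ T θ) P := by
  rw [funext (affineProd_eq_sum θ)]
  exact integrable_finsetSum _ fun α _ => (hP.integrable_elementaryIntegral hinf
    (fun _ => hT.measurableSet_atom _) (fun _ => hT.measure_atom_lt_top _)
    (pairwise_disjoint_atom_equivFin α)).const_mul _

lemma IsPoisson.setIntegral_affineProd (hP : IsPoisson μ P) (hinf : μ Set.univ = ∞)
    (hT : IsFiniteMeasureFamily μ T) (θ : atomIndex μ T → ℝ) {S : Set (CountingMeasure X)}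
    (hS : IsUncorrelated μ P S) :
    ∫ ν in S, affineProd μ T θ ν ∂P = P.real S * ∫ ν, affineProd μ T θ ν ∂P := by
  have hi : ∀ α : Finset (atomIndex μ T), Integrable (elementaryIntegral μ
      fun i : Fin α.card => atom T (α.equivFin.symm i).1) P := fun α =>
    hP.integrable_elementaryIntegral hinf (fun _ => hT.measurableSet_atom _)
      (fun _ => hT.measure_atom_lt_top _) (pairwise_disjoint_atom_equivFin α)
  rw [funext (affineProd_eq_sum θ), integral_finsetSum _ fun α _ => (hi α).integrableOn.const_mul _,
    integral_finsetSum _ fun α _ => (hi α).const_mul _, Finset.mul_sum]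
  refine Finset.sum_congr rfl fun α _ => ?_
  rw [integral_const_mul, integral_const_mul, hS _ _ (fun _ => hT.measurableSet_atom _)
    (fun _ => hT.measure_atom_lt_top _) (pairwise_disjoint_atom_equivFin α)]
  ring

lemma norm_setIntegral_sub_le {S : Set (CountingMeasure X)} {W Z : CountingMeasure X → ℂ}
    (hW : Integrable W P) (hZ : Integrable Z P)
    (h : ∫ ν in S, Z ν ∂P = P.real S * ∫ ν, Z ν ∂P) :
    ‖∫ ν in S, W ν ∂P - P.real S * ∫ ν, W ν ∂P‖ ≤ 2 * ∫ ν, ‖W ν - Z ν‖ ∂P := by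
  have h1 : ∫ ν in S, W ν ∂P - P.real S * ∫ ν, W ν ∂P =
      ∫ ν in S, (W ν - Z ν) ∂P - P.real S * ∫ ν, (W ν - Z ν) ∂P := by
    rw [integral_sub hW.integrableOn hZ.integrableOn, integral_sub hW hZ, h]
    ring
  have h2 : ‖∫ ν in S, (W ν - Z ν) ∂P‖ ≤ ∫ ν, ‖W ν - Z ν‖ ∂P :=
    (norm_integral_le_integral_norm _).trans
      (setIntegral_le_integral (hW.sub hZ).norm (Filter.Eventually.of_forall fun _ => norm_nonneg _))
  have h3 : ‖(P.real S : ℂ) * ∫ ν, (W ν - Z ν) ∂P‖ ≤ ∫ ν, ‖W ν - Z ν‖ ∂P := by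
    rw [norm_mul, Complex.norm_real, Real.norm_of_nonneg measureReal_nonneg]
    refine (mul_le_of_le_one_left (norm_nonneg _) measureReal_le_one).trans
      (norm_integral_le_integral_norm _)
  rw [h1]
  exact (norm_sub_le _ _).trans (by linarith)

omit [SigmaFinite μ] in
lemma IsPoisson.integral_norm_exp_sub_affineProd_le (hP : IsPoisson μ P)
    (hT : IsFiniteMeasureFamily μ T) (θ : atomIndex μ T → ℝ) {ε : ℝ} (hε : 0 < ε)
    (hsmall : 16 * ∑ σ : atomIndex μ T, ((μ (atom T σ)).toNNReal : ℝ) ^ 2 ≤ ε ^ 2) :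
    ∫ ν, ‖Complex.exp ((∑ σ : atomIndex μ T, θ σ * count (atom T σ) ν : ℝ) * Complex.I) -
      affineProd μ T θ ν‖ ∂P ≤ 2 * ε := by
  obtain ⟨h1, h2⟩ := (hP.isPoissonFamily hT).integral_norm_exp_sub_prod_sq_le θ
  -- This elementary inequality takes the place of Cauchy–Schwarz in passing from the `L²` to the
  -- `L¹` bound.
  have h3 : ∀ u : ℝ, u ≤ ε + u ^ 2 / ε := fun u => by
    have h4 : ε + u ^ 2 / ε - u = ((u - ε / 2) ^ 2 + 3 / 4 * ε ^ 2) / ε := by field_simp; ring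
    have h5 : 0 ≤ ((u - ε / 2) ^ 2 + 3 / 4 * ε ^ 2) / ε := by positivity
    linarith
  refine (integral_mono_of_nonneg (Filter.Eventually.of_forall fun _ => norm_nonneg _)
    ((integrable_const ε).add (h1.div_const ε)) (Filter.Eventually.of_forall fun ν => h3 _)).trans ?_
  rw [integral_add' (integrable_const ε) (h1.div_const ε), integral_div, integral_const, probReal_univ,
    one_smul]
  have h4 := h2.trans hsmall
  have h5 : ε ^ 2 / ε = ε := by field_simp
  have h6 := div_le_div_of_nonneg_right h4 hε.le
  rw [h5] at h6
  linarith

end Exponentials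

/-! ### An uncorrelated event is independent of itself. -/

section Independence

open Classical in
/-- Every finite family of sets of finite measure can be refined so that the atoms are small. -/
lemma IsFiniteMeasureFamily.exists_refinement {T : Finset (Set X)}
    (hT : IsFiniteMeasureFamily μ T) (hcont : IsContinuous μ) {δ : ℝ≥0∞} (hδ : 0 < δ) :
    ∃ T' : Finset (Set X), T ⊆ T' ∧ IsFiniteMeasureFamily μ T' ∧
      (∀ σ : atomIndex μ T', μ (atom T' σ) ≤ δ) ∧
      ∑ σ : atomIndex μ T', μ (atom T' σ) ≤ μ (⋃ A ∈ T, A) := by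
  have h : ∀ A ∈ T, ∃ 𝒟 : Finset (Set X), (∀ D ∈ 𝒟, MeasurableSet D ∧ D ⊆ A ∧ μ D ≤ δ) ∧
      A ⊆ ⋃ D ∈ 𝒟, D := fun A hA => hcont.exists_finset_cover (hT A hA).1 (hT A hA).2 hδ
  choose! 𝒟 h1 h2 using h
  have hT' : IsFiniteMeasureFamily μ (T ∪ T.biUnion 𝒟) := by
    intro B hB
    rcases Finset.mem_union.1 hB with hB | hB
    · exact hT B hB
    · obtain ⟨A, hA, hBA⟩ := Finset.mem_biUnion.1 hB
      exact ⟨(h1 A hA B hBA).1, (measure_mono (h1 A hA B hBA).2.1).trans_lt (hT A hA).2⟩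
  have hsub : ∀ σ : atomIndex μ (T ∪ T.biUnion 𝒟), ∃ A ∈ T, ∃ D ∈ 𝒟 A,
      (atom (T ∪ T.biUnion 𝒟) σ) ⊆ D := by
    intro σ
    obtain ⟨hσ, ⟨B, hB⟩, hpos⟩ := mem_atomIndex.1 σ.2
    rcases Finset.mem_union.1 (hσ hB) with hBT | hBT
    -- A point of the atom lies in some piece `D` covering `B`; since `D` belongs to the refined
    -- family, the whole atom lies in `D`.
    · obtain ⟨x, hx⟩ := nonempty_of_measure_ne_zero hpos.ne'
      have hxB := atom_subset hσ hB hx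
      obtain ⟨D, hD⟩ := Set.mem_iUnion.1 (h2 B hBT hxB)
      obtain ⟨hD, hxD⟩ := Set.mem_iUnion.1 hD
      have hDT : D ∈ T ∪ T.biUnion 𝒟 :=
        Finset.mem_union_right _ (Finset.mem_biUnion.2 ⟨B, hBT, hD⟩)
      exact ⟨B, hBT, D, hD, atom_subset hσ ((mem_of_mem_atom hx hDT).2 hxD)⟩
    · obtain ⟨A, hA, hBA⟩ := Finset.mem_biUnion.1 hBT
      exact ⟨A, hA, B, hBA, atom_subset hσ hB⟩
  refine ⟨T ∪ T.biUnion 𝒟, Finset.subset_union_left, hT', fun σ => ?_, ?_⟩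
  · obtain ⟨A, hA, D, hD, hσD⟩ := hsub σ
    exact (measure_mono hσD).trans (h1 A hA D hD).2.2
  · have hdis : Pairwise fun σ τ : atomIndex μ (T ∪ T.biUnion 𝒟) =>
        Disjoint (atom (T ∪ T.biUnion 𝒟) σ) (atom (T ∪ T.biUnion 𝒟) τ) :=
      fun σ τ h => pairwise_disjoint_atom _ fun h' => h (Subtype.ext h')
    rw [← measure_biUnion_finset (fun _ _ _ _ h => hdis h) fun σ _ => hT'.measurableSet_atom σ]
    refine measure_mono (Set.iUnion₂_subset fun σ _ => ?_)
    obtain ⟨A, hA, D, hD, hσD⟩ := hsub σ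
    exact (hσD.trans (h1 A hA D hD).2.1).trans (Set.subset_biUnion_of_mem (u := fun A => A) hA)

variable [SigmaFinite μ] [IsProbabilityMeasure P]

/-- Rewrite the exponent over the atoms of a fine refinement and compare with `affineProd`, for
which the identity is exact; the `L¹` error is arbitrarily small. -/
lemma IsPoisson.setIntegral_exp_eq (hP : IsPoisson μ P) (hinf : μ Set.univ = ∞)
    (hcont : IsContinuous μ) {S : Set (CountingMeasure X)} (hS : IsUncorrelated μ P S)
    {κ : Type*} [Fintype κ] {A : κ → Set X} (hA : ∀ k, MeasurableSet (A k))
    (hA' : ∀ k, μ (A k) < ∞) (θ : κ → ℝ) :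
    ∫ ν in S, Complex.exp ((∑ k, θ k * count (A k) ν : ℝ) * Complex.I) ∂P =
      P.real S * ∫ ν, Complex.exp ((∑ k, θ k * count (A k) ν : ℝ) * Complex.I) ∂P := by
  classical
  set W : CountingMeasure X → ℂ := fun ν =>
    Complex.exp ((∑ k, θ k * count (A k) ν : ℝ) * Complex.I) with hWdef
  have hcm := fun k => measurable_count (hA k)
  have hW : Integrable W P := by
    refine Integrable.of_bound (C := 1) (by fun_prop) (Filter.Eventually.of_forall fun ν => ?_)
    exact (Complex.norm_exp_ofReal_mul_I _).le
  have hT : IsFiniteMeasureFamily μ (Finset.univ.image A) := fun B hB => by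
    obtain ⟨k, -, rfl⟩ := Finset.mem_image.1 hB
    exact ⟨hA k, hA' k⟩
  set U : Set X := ⋃ B ∈ Finset.univ.image A, B
  have hU : μ U < ∞ := measure_biUnion_lt_top (Finset.finite_toSet _) fun B hB => (hT B hB).2
  have key : ∀ ε > 0, ‖∫ ν in S, W ν ∂P - P.real S * ∫ ν, W ν ∂P‖ ≤ 4 * ε := by
    intro ε hε
    -- Atoms of measure at most `δ` and total measure at most `μ U` satisfy `16 ∑ r² ≤ 16 δ μ(U) ≤
    -- ε²`; the `+ 1` keeps the denominator positive.
    set δ : ℝ := ε ^ 2 / (16 * ((μ U).toReal + 1)) with hδdef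
    have hδ : 0 < δ := by positivity
    obtain ⟨T, hTsub, hTfin, hTδ, hTsum⟩ :=
      hT.exists_refinement hcont (ENNReal.ofReal_pos.2 hδ)
    set θ' : atomIndex μ T → ℝ := fun σ => ∑ k with A k ∈ σ.1, θ k with hθ'
    have hWae : W =ᵐ[P] fun ν =>
        Complex.exp ((∑ σ : atomIndex μ T, θ' σ * count (atom T σ) ν : ℝ) * Complex.I) := by
      filter_upwards [hP.ae_count_eq_sum hinf hTfin] with ν hν
      have h1 : ∑ k, θ k * count (A k) ν = ∑ σ : atomIndex μ T, θ' σ * count (atom T σ) ν := by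
        have h2 : ∀ k, count (A k) ν =
            ∑ σ : atomIndex μ T with A k ∈ σ.1, count (atom T σ) ν := fun k =>
          (hν _ (hTsub (Finset.mem_image_of_mem A (Finset.mem_univ k)))).2
        simp_rw [h2, hθ', Finset.sum_filter, Finset.mul_sum, Finset.sum_mul]
        rw [Finset.sum_comm]
        refine Finset.sum_congr rfl fun σ _ => Finset.sum_congr rfl fun k _ => ?_
        split_ifs <;> simp
      rw [hWdef]
      simp only [h1]
    have hle : ∀ σ : atomIndex μ T, ((μ (atom T σ)).toNNReal : ℝ) ≤ δ := fun σ =>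
      ENNReal.toReal_le_of_le_ofReal hδ.le (hTδ σ)
    have hsum : ∑ σ : atomIndex μ T, ((μ (atom T σ)).toNNReal : ℝ) ≤ (μ U).toReal := by
      have h1 := ENNReal.toReal_mono hU.ne hTsum
      rwa [ENNReal.toReal_sum fun σ _ => (hTfin.measure_atom_lt_top σ).ne] at h1
    have hsmall : 16 * ∑ σ : atomIndex μ T, ((μ (atom T σ)).toNNReal : ℝ) ^ 2 ≤ ε ^ 2 := by
      have h1 : ∑ σ : atomIndex μ T, ((μ (atom T σ)).toNNReal : ℝ) ^ 2 ≤ δ * (μ U).toReal := by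
        refine le_trans ?_ (mul_le_mul_of_nonneg_left hsum hδ.le)
        rw [Finset.mul_sum]
        refine Finset.sum_le_sum fun σ _ => ?_
        rw [pow_two]
        exact mul_le_mul_of_nonneg_right (hle σ) (by positivity)
      have h2 : 16 * (δ * ((μ U).toReal + 1)) = ε ^ 2 := by
        rw [hδdef]
        field_simp
      nlinarith
    have h1 := norm_setIntegral_sub_le hW (hP.integrable_affineProd hinf hTfin θ')
      (hP.setIntegral_affineProd hinf hTfin θ' hS)
    have h2 := hP.integral_norm_exp_sub_affineProd_le hTfin θ' hε hsmall
    have h3 : ∫ ν, ‖W ν - affineProd μ T θ' ν‖ ∂P =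
        ∫ ν, ‖Complex.exp ((∑ σ : atomIndex μ T, θ' σ * count (atom T σ) ν : ℝ) * Complex.I) -
          affineProd μ T θ' ν‖ ∂P := by
      refine integral_congr_ae ?_
      filter_upwards [hWae] with ν hν
      rw [hν]
    linarith
  rw [← sub_eq_zero, ← norm_le_zero_iff]
  refine le_of_forall_pos_le_add fun ε hε => ?_
  have := key (ε / 4) (by positivity)
  linarith

/-- The joint law of the numbers of points is the same under `P` and under `P` conditioned on `S`. -/
lemma IsPoisson.map_restrict_eq (hP : IsPoisson μ P) (hinf : μ Set.univ = ∞)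
    (hcont : IsContinuous μ) {S : Set (CountingMeasure X)} (hS : IsUncorrelated μ P S)
    {κ : Type*} [Fintype κ] {A : κ → Set X} (hA : ∀ k, MeasurableSet (A k))
    (hA' : ∀ k, μ (A k) < ∞) :
    (P.restrict S).map (fun ν k => N (A k) ν) =
      ((P S).toNNReal • P).map (fun ν k => N (A k) ν) := by
  classical
  have hm : Measurable fun (ν : CountingMeasure X) k => count (A k) ν :=
    measurable_pi_lambda _ fun k => measurable_count (hA k)
  have h1 : (P.restrict S).map (fun ν k => count (A k) ν) =
      ((P S).toNNReal • P).map (fun ν k => count (A k) ν) := by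
    -- Finite measures with equal characteristic functions coincide. The real counts are used for
    -- this and then carried back to `N`, which is almost surely finite.
    refine Measure.ext_of_charFunDual (funext fun L => ?_)
    have hL : ∀ ν : CountingMeasure X, L (fun k => count (A k) ν) =
        ∑ k, L (fun j => if k = j then 1 else 0) * count (A k) ν := fun ν => by
      rw [← ContinuousLinearMap.coe_coe, LinearMap.pi_apply_eq_sum_univ]
      exact Finset.sum_congr rfl fun k _ => mul_comm _ _
    have hLm : Measurable fun v : κ → ℝ => Complex.exp (L v * Complex.I) := by fun_prop
    rw [charFunDual_apply, charFunDual_apply,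
      integral_map hm.aemeasurable hLm.aestronglyMeasurable,
      integral_map hm.aemeasurable hLm.aestronglyMeasurable]
    simp_rw [hL]
    rw [hP.setIntegral_exp_eq hinf hcont hS hA hA', integral_smul_nnreal_measure]
    rw [NNReal.smul_def, Complex.real_smul]
    rfl
  have h2 : ∀ᵐ ν ∂P, (fun k => N (A k) ν) = fun k => ENNReal.ofReal (count (A k) ν) := by
    have : ∀ᵐ ν ∂P, ∀ k, N (A k) ν < ∞ :=
      ae_all_iff.2 fun k => hP.ae_N_lt_top hinf (hA k) (hA' k)
    filter_upwards [this] with ν hν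
    exact funext fun k => (ENNReal.ofReal_toReal (hν k).ne).symm
  have hg : Measurable fun (v : κ → ℝ) k => ENNReal.ofReal (v k) := by fun_prop
  rw [Measure.map_congr (ae_restrict_of_ae h2),
    Measure.map_congr (μ := (P S).toNNReal • P) (Measure.ae_smul_measure h2 _)]
  have h3 := congrArg (Measure.map fun (v : κ → ℝ) k => ENNReal.ofReal (v k)) h1
  rwa [Measure.map_map hg hm, Measure.map_map hg hm] at h3

/-- Sets of finite measure already generate: `N A` is the increasing limit of the counts in `A ∩
spanningSets μ k`. -/
lemma sigmaAlgebra_le_comap :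
    CountingMeasure.sigmaAlgebra ≤ MeasurableSpace.comap
      (fun (ν : CountingMeasure X) (A : {A : Set X // MeasurableSet A ∧ μ A < ∞}) => N A.1 ν)
      MeasurableSpace.pi := by
  refine iSup₂_le fun A hA => ?_
  rw [← BorelSpace.measurable_eq (α := ℝ≥0∞), ← measurable_iff_comap_le]
  have h : N A = fun ν : CountingMeasure X => ⨆ k, N (A ∩ spanningSets μ k) ν := by
    funext ν
    have hmono : Monotone fun k => A ∩ spanningSets μ k := fun i j hij =>
      Set.inter_subset_inter_right A (monotone_spanningSets μ hij)
    have h1 := hmono.measure_iUnion (μ := ν.1)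
    rw [← Set.inter_iUnion, iUnion_spanningSets, Set.inter_univ] at h1
    exact h1
  rw [h]
  refine Measurable.iSup (ι := ℕ) (mδ := _) fun k => ?_
  have hk : MeasurableSet (A ∩ spanningSets μ k) ∧ μ (A ∩ spanningSets μ k) < ∞ :=
    ⟨hA.inter (measurableSet_spanningSets μ k),
      (measure_mono Set.inter_subset_right).trans_lt (measure_spanningSets_lt_top μ k)⟩
  have heval : Measurable fun f : {A : Set X // MeasurableSet A ∧ μ A < ∞} → ℝ≥0∞ => f ⟨_, hk⟩ :=
    measurable_pi_apply _
  exact heval.comp (comap_measurable _)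

/-- An event which is uncorrelated with the elementary integrals is trivial. -/
lemma IsPoisson.measure_eq_zero_or_one (hP : IsPoisson μ P) (hinf : μ Set.univ = ∞)
    (hcont : IsContinuous μ) {S : Set (CountingMeasure X)} (hSm : MeasurableSet S)
    (hS : IsUncorrelated μ P S) : P S = 0 ∨ P S = 1 := by
  set R : CountingMeasure X → {A : Set X // MeasurableSet A ∧ μ A < ∞} → ℝ≥0∞ :=
    fun ν A => N A.1 ν
  have hR : Measurable R := measurable_pi_lambda _ fun A => measurable_N A.2.1
  have h1 : (P.restrict S).map R = ((P S).toNNReal • P).map R := by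
    -- Finite-dimensional marginals determine the law of the whole family of counts.
    have h2 : IsProjectiveLimit (((P S).toNNReal • P).map R)
        (fun I => (((P S).toNNReal • P).map R).map I.restrict) := fun I => rfl
    refine IsProjectiveLimit.unique (fun I => ?_) h2
    rw [Measure.map_map (Finset.measurable_restrict I) hR,
      Measure.map_map (Finset.measurable_restrict I) hR]
    exact hP.map_restrict_eq hinf hcont hS (A := fun A : I => A.1.1) (fun A => A.1.2.1)
      fun A => A.1.2.2
  obtain ⟨E, hE, rfl⟩ := sigmaAlgebra_le_comap (μ := μ) S hSm
  -- The event is itself of the form `R ⁻¹' E`; evaluating both laws on `E` gives `P(S) = P(S)²`.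
  have h3 : P (R ⁻¹' E) = (P (R ⁻¹' E)).toNNReal • P (R ⁻¹' E) := by
    have h4 := congrArg (fun m => m E) h1
    simp only [Measure.map_apply hR hE] at h4
    rwa [Measure.restrict_apply_self] at h4
  rw [ENNReal.smul_def, smul_eq_mul, ENNReal.coe_toNNReal (measure_ne_top P _)] at h3
  by_cases h0 : P (R ⁻¹' E) = 0
  · exact Or.inl h0
  · refine Or.inr ?_
    have h5 : P (R ⁻¹' E) * 1 = P (R ⁻¹' E) * P (R ⁻¹' E) := by rwa [mul_one]
    exact ((ENNReal.mul_right_inj h0 (measure_ne_top P _)).1 h5).symm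

end Independence

end

/-! ### Conditional expectation on a trivial `σ`-algebra, and conclusion. -/

section TrivialSigmaAlgebra

lemma condExp_ae_eq_const {Ω : Type*} {C m0 : MeasurableSpace Ω} {P : Measure Ω}
    [IsProbabilityMeasure P] (hC : C ≤ m0)
    (htriv : ∀ S : Set Ω, MeasurableSet[C] S → P S = 0 ∨ P S = 1) {f : Ω → ℂ}
    (hf : Integrable f P) : P[f | C] =ᵐ[P] fun _ => ∫ ω, f ω ∂P := by
  symm
  refine ae_eq_condExp_of_forall_setIntegral_eq hC hf
    (fun s _ _ => (integrable_const _).integrableOn) (fun s hs _ => ?_)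
    stronglyMeasurable_const.aestronglyMeasurable
  rcases htriv s hs with h | h
  · rw [Measure.restrict_eq_zero.2 h]
    simp
  · have hs' : ∀ᵐ ω ∂P, ω ∈ s := by
      rw [← prob_compl_eq_zero_iff (hC s hs)] at h
      exact h
    rw [Measure.restrict_eq_self_of_ae_mem hs']
    simp

lemma condExpOp_eq_condExpOp_bot {Ω : Type*} {C m0 : MeasurableSpace Ω} {P : Measure Ω}
    [IsProbabilityMeasure P] (hC : C ≤ m0)
    (htriv : ∀ S : Set Ω, MeasurableSet[C] S → P S = 0 ∨ P S = 1) :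
    condExpOp C P hC = condExpOp ⊥ P bot_le := by
  ext1 F
  have hF : MemLp F 2 P := Lp.memLp F
  have hop : ∀ (D : MeasurableSpace Ω) (hD : D ≤ m0), condExpOp D P hD F =ᵐ[P] P[F | D] :=
    fun D hD => by
      have h := hF.condExpL2_ae_eq_condExp (𝕜 := ℂ) hD
      rwa [Lp.toLp_coeFn] at h
  refine Lp.ext ((hop C hC).trans (Filter.EventuallyEq.trans ?_ (hop ⊥ bot_le).symm))
  rw [condExp_bot]
  exact condExp_ae_eq_const hC htriv (hF.integrable (by norm_num))

end TrivialSigmaAlgebra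

variable {X : Type*} [MeasurableSpace X] {μ : Measure X} [SigmaFinite μ]
  {P : Measure (CountingMeasure X)} [IsProbabilityMeasure P]
  {C : MeasurableSpace (CountingMeasure X)} {hC : C ≤ CountingMeasure.sigmaAlgebra}

/-- In order zero the elementary integral is the constant `1`. In positive order its integral over
every event of `C`, the whole space included, is zero, so both sides vanish. -/
lemma IsPoisson.isUncorrelated_of_condExpOp_eq_zero (hP : IsPoisson μ P)
    (hinf : μ Set.univ = ∞)
    (hzero : ∀ n : ℕ, 1 ≤ n → ∀ F ∈ chaos μ P n, condExpOp C P hC F = 0)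
    {S : Set (CountingMeasure X)} (hS : MeasurableSet[C] S) : IsUncorrelated μ P S := by
  intro n A hA hA' hd
  rcases Nat.eq_zero_or_pos n with rfl | hn
  · have : elementaryIntegral μ A = fun _ => 1 := funext fun ν => by simp [elementaryIntegral]
    simp [this]
  · have key : ∀ D : Set (CountingMeasure X), MeasurableSet[C] D →
        ∫ ν in D, elementaryIntegral μ A ν ∂P = 0 := fun D hD => by
      have h1 := setIntegral_condExpOp (hC := hC)
        (hP.memLp_elementaryIntegral hinf hA hA' hd).toLp hD
      rw [hzero n hn _ (hP.toLp_elementaryIntegral_mem_chaos hinf hA hA' hd),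
        integral_congr_ae (ae_restrict_of_ae (Lp.coeFn_zero ℂ 2 P)),
        integral_congr_ae (ae_restrict_of_ae (MemLp.coeFn_toLp _))] at h1
      simpa using h1.symm
    have h2 := key Set.univ MeasurableSet.univ
    rw [Measure.restrict_univ] at h2
    rw [key S hS, h2, mul_zero]

end PoissonChaos

theorem theorem2p3 {X : Type*} [MeasurableSpace X] (μ : Measure X) [SigmaFinite μ]
    (hinf : μ Set.univ = ∞) (hcont : PoissonChaos.IsContinuous μ)
    (P : Measure (PoissonChaos.CountingMeasure X)) [IsProbabilityMeasure P]
    (hP : PoissonChaos.IsPoisson μ P)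
    (C : MeasurableSpace (PoissonChaos.CountingMeasure X))
    (hC : C ≤ PoissonChaos.CountingMeasure.sigmaAlgebra)
    (hpres : ∀ n : ℕ, 1 ≤ n → ∀ F ∈ PoissonChaos.chaos μ P n,
      PoissonChaos.condExpOp C P hC F ∈ PoissonChaos.chaos μ P n)
    (hzero : ∀ F ∈ PoissonChaos.chaos μ P 1, PoissonChaos.condExpOp C P hC F = 0) :
    (∀ n : ℕ, 1 ≤ n → ∀ F ∈ PoissonChaos.chaos μ P n, PoissonChaos.condExpOp C P hC F = 0) ∧
    PoissonChaos.condExpOp C P hC = PoissonChaos.condExpOp ⊥ P bot_le ∧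
    ∀ S : Set (PoissonChaos.CountingMeasure X), MeasurableSet[C] S → P S = 0 ∨ P S = 1 := by
  have h1 : ∀ n : ℕ, 1 ≤ n → ∀ F ∈ PoissonChaos.chaos μ P n,
      PoissonChaos.condExpOp C P hC F = 0 := fun n hn F hF =>
    hP.condExpOp_eq_zero hinf hpres hzero hn hF
  have h2 : ∀ S : Set (PoissonChaos.CountingMeasure X), MeasurableSet[C] S → P S = 0 ∨ P S = 1 :=
    fun S hS => hP.measure_eq_zero_or_one hinf hcont (hC S hS)
      (hP.isUncorrelated_of_condExpOp_eq_zero hinf h1 hS)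
  exact ⟨h1, PoissonChaos.condExpOp_eq_condExpOp_bot hC h2, h2⟩
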